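/- Let $X$ be a finite alphabet and let $X^*$ be the rooted tree of finite words over $X$. For an automorphism $g$ of the rooted tree $X^*$ and a word $v\in X^*$, let $g|_v$ be the automorphism of $X^*$ determined by $g(vw)=g(v)\,g|_v(w)$ for all $w\in X^*$. Call $g$ bounded if its action on $X^*$ is the action of a state of a finite automaton over $X$ and the sequence $\theta(k,g)$, $k\ge 0$, is bounded, where $\theta(k,g)$ is the number of words $v\in X^k$ such that $g|_v$ acts non-trivially on the first level $X^1$. The bounded automorphisms of $X^*$ form a group $\mathcal{B}$. Then every finitely generated subgroup $G$ of $\mathcal{B}$ has word problem solvable in polynomial time: for every finite family $s_1,\dots,s_n$ generating $G$ there are a multi-stack (equivalently, multi-tape) Turing machine and a polynomial $p$ such that, for every word $w$ in the letters $s_1^{\pm1},\dots,s_n^{\pm1}$, the machine decides on input $w$, in at most $p(|w|)$ steps, whether $w$ represents the identity element of $G$. -/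

import Mathlib

universe u

namespace BoundedAutomata

/-! ### The rooted tree `X^*` and its automorphisms -/

/-- The automorphism group of the rooted tree `X^*` of finite words over the alphabet `X`
(with a word `v` joined to the words `vx`, `x ∈ X`, and the empty word as root): the bijections of
`X^*` which preserve the length of words and the relation of being a prefix. -/
def TreeAut (X : Type u) : Subgroup (Equiv.Perm (List X)) where
  carrier := {g | (∀ v, (g v).length = v.length) ∧ ∀ v w, v <+: w → g v <+: g w}
  mul_mem' := by
    rintro g h ⟨hg, hg'⟩ ⟨hh, hh'⟩
    exact ⟨fun v => by rw [Equiv.Perm.mul_apply, hg, hh],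
      fun v w hvw => hg' _ _ (hh' _ _ hvw)⟩
  one_mem' := ⟨fun _ => rfl, fun _ _ h => h⟩
  inv_mem' := by
    rintro g ⟨hg, hg'⟩
    have happ : ∀ v, g (g⁻¹ v) = v := fun v => g.apply_symm_apply v
    have hlen : ∀ v, (g⁻¹ v).length = v.length := fun v => by
      rw [← hg (g⁻¹ v), happ]
    refine ⟨hlen, fun v w hvw => ?_⟩
    have h1 : (g⁻¹ w).take v.length <+: g⁻¹ w := List.take_prefix _ _
    have h2 := hg' _ _ h1
    rw [happ] at h2
    have h3 : (g ((g⁻¹ w).take v.length)).length = v.length := by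
      rw [hg, List.length_take, hlen]
      exact min_eq_left hvw.length_le
    have h4 : g ((g⁻¹ w).take v.length) = v :=
      (List.prefix_of_prefix_length_le h2 hvw h3.le).eq_of_length h3
    have h5 : g⁻¹ v = (g⁻¹ w).take v.length := by
      rw [Equiv.Perm.inv_eq_iff_eq]
      exact h4.symm
    rw [h5]
    exact h1

/-- The restriction `g|_v` of a tree automorphism `g` at the word `v`: the transformation of `X^*`
with `g(vw) = g(v) g|_v(w)`, see `apply_append`. -/
def restriction {X : Type u} (g : TreeAut X) (v : List X) : List X → List X :=
  fun w => (g.1 (v ++ w)).drop v.length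

theorem apply_append {X : Type u} (g : TreeAut X) (v w : List X) :
    g.1 (v ++ w) = g.1 v ++ restriction g v w := by
  obtain ⟨t, ht⟩ := g.2.2 v (v ++ w) (List.prefix_append v w)
  have hl := g.2.1 v
  unfold restriction
  rw [← ht, ← hl, List.drop_left]

/-! ### Automata -/

/-- An automaton over the alphabet `X` with set of states `Q`, transition function `π` and output
function `lam`. -/
structure Automaton (X : Type u) (Q : Type u) where
  π : Q → X → Q
  lam : Q → X → X

/-- The action of a state of an automaton on words: `q(xv) = q(x) q|_x(v)`. -/
def Automaton.act {X Q : Type u} (A : Automaton X Q) : Q → List X → List X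
  | _, [] => []
  | q, x :: v => A.lam q x :: A.act (A.π q x) v

/-- `g` is defined by a state of a finite automaton. -/
def IsFiniteAutomatic {X : Type u} (g : TreeAut X) : Prop :=
  ∃ (Q : Type u) (_ : Finite Q) (A : Automaton X Q) (q : Q), ∀ v, g.1 v = A.act q v

/-! ### Bounded automorphisms -/

/-- The words `v` of length `k` for which `g|_v` acts non-trivially on the first level `X^1`. -/
def activeWords {X : Type u} (k : ℕ) (g : TreeAut X) : Set (List X) :=
  {v | v.length = k ∧ ∃ x : X, restriction g v [x] ≠ [x]}

/-- `θ(k, g)`: the number of words `v ∈ X^k` such that `g|_v` acts non-trivially on `X^1`. -/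
noncomputable def theta {X : Type u} (k : ℕ) (g : TreeAut X) : ℕ :=
  (activeWords k g).ncard

/-- `g` is bounded: it is defined by a finite automaton and the sequence `θ(k, g)` is bounded. -/
def IsBounded {X : Type u} (g : TreeAut X) : Prop :=
  IsFiniteAutomatic g ∧ ∃ C : ℕ, ∀ k, theta k g ≤ C

section helpers

variable {X : Type u}

theorem restriction_mul (g h : TreeAut X) (v w : List X) :
    restriction (g * h) v w = restriction g (h.1 v) (restriction h v w) := by
  have h1 : g.1 (h.1 (v ++ w)) = g.1 (h.1 v) ++ restriction (g * h) v w := apply_append (g * h) v w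
  rw [apply_append h, apply_append g] at h1
  exact (List.append_cancel_left h1).symm

theorem restriction_one (v w : List X) : restriction (1 : TreeAut X) v w = w := by
  have h1 : v ++ w = v ++ restriction (1 : TreeAut X) v w := apply_append 1 v w
  exact (List.append_cancel_left h1).symm

theorem length_restriction (g : TreeAut X) (v w : List X) :
    (restriction g v w).length = w.length := by
  have h := congrArg List.length (apply_append g v w)
  rw [g.2.1, List.length_append, List.length_append, g.2.1] at h
  omega

theorem activeWords_finite [Finite X] (k : ℕ) (g : TreeAut X) : (activeWords k g).Finite :=
  (List.finite_length_eq X k).subset fun _ hv => hv.1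

theorem activeWords_one (k : ℕ) : activeWords k (1 : TreeAut X) = ∅ := by
  ext v
  simp [activeWords, restriction_one]

theorem theta_mul_le [Finite X] (k : ℕ) (g h : TreeAut X) :
    theta k (g * h) ≤ theta k g + theta k h := by
  have hsub : activeWords k (g * h) ⊆ h.1.symm '' activeWords k g ∪ activeWords k h := by
    rintro v ⟨hv, x, hx⟩
    by_cases hvh : v ∈ activeWords k h
    · exact Or.inr hvh
    · refine Or.inl ⟨h.1 v, ⟨by rw [h.2.1, hv], x, ?_⟩, h.1.symm_apply_apply v⟩
      have hhx : restriction h v [x] = [x] := by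
        by_contra hne
        exact hvh ⟨hv, x, hne⟩
      rwa [restriction_mul, hhx] at hx
  calc theta k (g * h) ≤ (h.1.symm '' activeWords k g ∪ activeWords k h).ncard :=
        Set.ncard_le_ncard hsub
          (((activeWords_finite k g).image _).union (activeWords_finite k h))
    _ ≤ (h.1.symm '' activeWords k g).ncard + (activeWords k h).ncard := Set.ncard_union_le _ _
    _ ≤ theta k g + theta k h :=
        Nat.add_le_add_right (Set.ncard_image_le (activeWords_finite k g)) _

theorem theta_inv_le [Finite X] (k : ℕ) (g : TreeAut X) : theta k g⁻¹ ≤ theta k g := by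
  have hsub : activeWords k g⁻¹ ⊆ g.1 '' activeWords k g := by
    rintro v ⟨hv, x, hx⟩
    have hgv : g.1 ((g⁻¹).1 v) = v := g.1.apply_symm_apply v
    refine ⟨(g⁻¹).1 v, ⟨by rw [(g⁻¹).2.1, hv], ?_⟩, hgv⟩
    obtain ⟨y, hy⟩ := List.length_eq_one_iff.1 (length_restriction g⁻¹ v [x])
    refine ⟨y, fun hc => hx ?_⟩
    have h1 := restriction_mul g g⁻¹ v [x]
    rw [mul_inv_cancel, restriction_one, hy, hc] at h1
    rw [hy, h1]
  exact (Set.ncard_le_ncard hsub ((activeWords_finite k g).image _)).trans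
    (Set.ncard_image_le (activeWords_finite k g))

theorem isFiniteAutomatic_one : IsFiniteAutomatic (1 : TreeAut X) := by
  refine ⟨PUnit, inferInstance, ⟨fun q _ => q, fun _ x => x⟩, PUnit.unit, fun v => ?_⟩
  change v = _
  induction v with
  | nil => rfl
  | cons x v ih => exact congrArg (x :: ·) ih

theorem IsFiniteAutomatic.mul {g h : TreeAut X} (hg : IsFiniteAutomatic g)
    (hh : IsFiniteAutomatic h) : IsFiniteAutomatic (g * h) := by
  obtain ⟨Q, _, A, q, hA⟩ := hg
  obtain ⟨R, _, B, r, hB⟩ := hh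
  let C : Automaton X (Q × R) :=
    ⟨fun p x => (A.π p.1 (B.lam p.2 x), B.π p.2 x), fun p x => A.lam p.1 (B.lam p.2 x)⟩
  refine ⟨Q × R, inferInstance, C, (q, r), fun v => ?_⟩
  change g.1 (h.1 v) = _
  rw [hB, hA]
  clear hA hB
  induction v generalizing q r with
  | nil => rfl
  | cons x v ih => exact congrArg (_ :: ·) (ih _ _)

open Classical in
theorem IsFiniteAutomatic.inv {g : TreeAut X} (hg : IsFiniteAutomatic g) :
    IsFiniteAutomatic g⁻¹ := by
  obtain ⟨Q, _, A, q, hA⟩ := hg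
  let back : Q → X → X := fun p y => if h : ∃ x, A.lam p x = y then h.choose else y
  let B : Automaton X Q := ⟨fun p y => A.π p (back p y), back⟩
  have key : ∀ (v : List X) (p : Q), Function.Injective (A.act p) →
      B.act p (A.act p v) = v := by
    intro v
    induction v with
    | nil => intro p _; rfl
    | cons x v ih =>
      intro p hp
      have hinj : Function.Injective (A.lam p) := by
        intro a b hab
        have : A.act p [a] = A.act p [b] := by simp [Automaton.act, hab]
        simpa using hp this
      have hback : back p (A.lam p x) = x := by
        have hex : ∃ z, A.lam p z = A.lam p x := ⟨x, rfl⟩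
        simp only [back, dif_pos hex]
        exact hinj hex.choose_spec
      have hnext : Function.Injective (A.act (A.π p x)) := by
        intro a b hab
        have : A.act p (x :: a) = A.act p (x :: b) := by simp [Automaton.act, hab]
        simpa using hp this
      change back p (A.lam p x) :: B.act (A.π p (back p (A.lam p x))) (A.act (A.π p x) v) = _
      rw [hback, ih _ hnext]
  refine ⟨Q, inferInstance, B, q, fun v => ?_⟩
  have hq : Function.Injective (A.act q) := by
    intro a b hab
    rw [← hA, ← hA] at hab
    exact g.1.injective hab
  have h1 := key ((g⁻¹).1 v) q hq
  rw [← hA] at h1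
  have hgv : g.1 ((g⁻¹).1 v) = v := g.1.apply_symm_apply v
  rw [hgv] at h1
  exact h1.symm

end helpers

/-- The group `𝓑` of all bounded automorphisms of the tree `X^*`. -/
def boundedGroup (X : Type u) [Finite X] : Subgroup (TreeAut X) where
  carrier := {g | IsBounded g}
  mul_mem' := by
    rintro g h ⟨hg, C, hC⟩ ⟨hh, D, hD⟩
    exact ⟨hg.mul hh, C + D, fun k =>
      (theta_mul_le k g h).trans (Nat.add_le_add (hC k) (hD k))⟩
  one_mem' := ⟨isFiniteAutomatic_one, 0, fun k => by simp [theta, activeWords_one]⟩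
  inv_mem' := by
    rintro g ⟨hg, C, hC⟩
    exact ⟨hg.inv, C, fun k => (theta_inv_le k g).trans (hC k)⟩

/-! ### The word problem -/

/-- The value in the group `G` of a word in the letters `sᵢ` (encoded as `(i, true)`) and
`sᵢ⁻¹` (encoded as `(i, false)`). -/
def wordValue {G : Type u} [Group G] {n : ℕ} (s : Fin n → G) (w : List (Fin n × Bool)) : G :=
  (w.map fun p => if p.2 then s p.1 else (s p.1)⁻¹).prod

/-- A set `L` of words over a finite alphabet `Γ` is decidable in polynomial time: some Turing
machine (with finitely many stacks) computes the characteristic function of `L`, the number of its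
steps being bounded by a polynomial in the length of the input word. -/
def DecidableInPolyTime {Γ : Type} (L : Set (List Γ)) : Prop :=
  open Classical in
  Nonempty (Turing.TM2ComputableInPolyTime (id : List Γ → List Γ) Computability.encodeBool
    (fun w => decide (w ∈ L)))

/-- The word problem of the finitely generated group `G` is solvable in polynomial time: for every
finite generating family `s` of `G`, it is decidable in polynomial time whether a word in
the letters `sᵢ` and their inverses represents the identity of `G`. -/
def WordProblemInPolyTime (G : Type u) [Group G] : Prop :=
  ∀ (n : ℕ) (s : Fin n → G), Subgroup.closure (Set.range s) = ⊤ →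
    DecidableInPolyTime {w : List (Fin n × Bool) | wordValue s w = 1}

end BoundedAutomata

/-! Let `S` be the set of all sections of the given letters. It is finite, and some `C` bounds, for
every element of `S` and every level, the number of words with nontrivial section
(`IsBounded.exists_ncard_le`). A section of a product of `m` letters is a product of sections of the
factors. Once trivial factors are deleted, the words representing all sections on one level have
total length at most `C * m`, so a machine can store a whole level and compute the next one in
linear time.

It remains to see that linearly many levels suffice (`exists_depth`). An automorphism is finitary if
its sections are trivial from some level on. Along a word `v`, a factor that has become finitary
stays so; hence the number of nonfinitary factors drops at most `m` times. A factor that stays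
nonfinitary must follow a cycle of sections: a second nonfinitary branch leaving a cycle would be
met on every turn and make the number of nontrivial sections unbounded (`eq_of_nonFinitary_sec`). So
if the count is constant on a window of fixed length, all factors have equal sections at two fixed
places of it (`exists_window`, `secList_eq_of_count_eq`), and the letters in between can be cut out
of `v`. A shortest active word therefore loses a nonfinitary factor in every window, which bounds
its length by `T * m`.

The machine side consists of a table-driven stack machine translated to `TM2`
(`StackMachine.decidableInPolyTime`) and the level-by-level exploration
(`Transducer.decidableInPolyTime_inactive`). -/

namespace BoundedAutomata

/-! ### Sections as tree automorphisms -/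

section sections

variable {X : Type u}

@[simp] theorem coe_mul_apply (g h : TreeAut X) (v : List X) : (g * h).1 v = g.1 (h.1 v) := rfl

@[simp] theorem coe_one_apply (v : List X) : (1 : TreeAut X).1 v = v := rfl

@[simp] theorem apply_inv_self (g : TreeAut X) (v : List X) : g.1 ((g⁻¹).1 v) = v :=
  g.1.apply_symm_apply v

@[simp] theorem inv_apply_self (g : TreeAut X) (v : List X) : (g⁻¹).1 (g.1 v) = v :=
  g.1.symm_apply_apply v

theorem treeAut_ext {g h : TreeAut X} (H : ∀ v, g.1 v = h.1 v) : g = h :=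
  Subtype.ext (Equiv.ext H)

theorem restriction_inv_restriction (g : TreeAut X) (v w : List X) :
    restriction g⁻¹ (g.1 v) (restriction g v w) = w := by
  rw [← restriction_mul, inv_mul_cancel, restriction_one]

/-- The section `g|_v` as a tree automorphism. -/
def sec (g : TreeAut X) (v : List X) : TreeAut X :=
  ⟨⟨restriction g v, restriction g⁻¹ (g.1 v), restriction_inv_restriction g v, fun w => by
      have h := restriction_inv_restriction g⁻¹ (g.1 v) w
      rwa [inv_inv, inv_apply_self] at h⟩,
    length_restriction g v, fun w w' ⟨t, ht⟩ => by
      change restriction g v w <+: restriction g v w'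
      subst ht
      have h1 := apply_append g v (w ++ t)
      rw [← List.append_assoc, apply_append g (v ++ w), apply_append g v w,
        List.append_assoc] at h1
      exact ⟨_, List.append_cancel_left h1⟩⟩

theorem apply_append' (g : TreeAut X) (v w : List X) :
    g.1 (v ++ w) = g.1 v ++ (sec g v).1 w :=
  apply_append g v w

theorem sec_apply (g : TreeAut X) (v w : List X) : (sec g v).1 w = restriction g v w := rfl

@[simp] theorem sec_one (v : List X) : sec (1 : TreeAut X) v = 1 :=
  treeAut_ext (restriction_one v)

theorem sec_mul (g h : TreeAut X) (v : List X) : sec (g * h) v = sec g (h.1 v) * sec h v :=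
  treeAut_ext (restriction_mul g h v)

@[simp] theorem apply_nil (g : TreeAut X) : g.1 [] = [] :=
  List.length_eq_zero_iff.1 (g.2.1 [])

@[simp] theorem sec_nil (g : TreeAut X) : sec g [] = g :=
  treeAut_ext fun w => by simpa using (apply_append' g [] w).symm

theorem sec_append (g : TreeAut X) (u v : List X) : sec g (u ++ v) = sec (sec g u) v := by
  refine treeAut_ext fun w => ?_
  have h1 := apply_append' g (u ++ v) w
  rw [List.append_assoc, apply_append' g u, apply_append' (sec g u) v, apply_append' g u v,
    List.append_assoc] at h1
  exact (List.append_cancel_left (List.append_cancel_left h1)).symm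

theorem apply_take (g : TreeAut X) (v : List X) (i : ℕ) : g.1 (v.take i) = (g.1 v).take i := by
  rcases le_total i v.length with h | h
  · have h1 := congrArg (List.take i) (apply_append' g (v.take i) (v.drop i))
    rw [List.take_append_drop] at h1
    rw [h1, List.take_append_of_le_length (by rw [g.2.1]; simp [h]),
      List.take_of_length_le (l := g.1 (v.take i)) (by rw [g.2.1]; simp)]
  · rw [List.take_of_length_le h, List.take_of_length_le (l := g.1 v) (by rwa [g.2.1])]

theorem eq_one_of_forall_restriction {g : TreeAut X}
    (h : ∀ v x, (sec g v).1 [x] = [x]) : g = 1 := by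
  refine treeAut_ext fun v => ?_
  induction v using List.reverseRecOn with
  | nil => simp
  | append_singleton v x ih => rw [apply_append', ih, h]; rfl

theorem exists_active_of_ne_one {g : TreeAut X} (h : g ≠ 1) :
    ∃ v x, (sec g v).1 [x] ≠ [x] := by
  by_contra hc
  push Not at hc
  exact h (eq_one_of_forall_restriction hc)

theorem Automaton.act_append {Q : Type u} (A : Automaton X Q) (q : Q) (v w : List X) :
    A.act q (v ++ w) = A.act q v ++ A.act (v.foldl A.π q) w := by
  induction v generalizing q with
  | nil => rfl
  | cons x v ih => simp [Automaton.act, ih]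

/-- The section at `v` acts as the state reached after reading `v`. -/
theorem IsFiniteAutomatic.finite_range_sec {g : TreeAut X} (hg : IsFiniteAutomatic g) :
    (Set.range (sec g)).Finite := by
  obtain ⟨Q, _, A, q, hA⟩ := hg
  have key : ∀ v w, (sec g v).1 w = A.act (v.foldl A.π q) w := fun v w => by
    have h1 := apply_append' g v w
    rw [hA, A.act_append, ← hA v] at h1
    exact (List.append_cancel_left h1).symm
  have hfac : ∀ v v', v.foldl A.π q = v'.foldl A.π q → sec g v = sec g v' := fun v v' h =>
    treeAut_ext fun w => by rw [key, key, h]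
  refine Set.Finite.of_finite_image (f := fun h : TreeAut X => fun w => h.1 w)
    ((Set.finite_range fun p : Q => A.act p).subset ?_)
    fun a _ b _ hab => treeAut_ext (congrFun hab)
  rintro _ ⟨_, ⟨v, rfl⟩, rfl⟩
  exact ⟨v.foldl A.π q, (funext (key v)).symm⟩

/-- The words of length `k` at which the section of `g` is nontrivial. -/
def nontrivialWords (k : ℕ) (g : TreeAut X) : Set (List X) :=
  {v | v.length = k ∧ sec g v ≠ 1}

theorem nontrivialWords_finite [Finite X] (k : ℕ) (g : TreeAut X) :
    (nontrivialWords k g).Finite :=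
  (List.finite_length_eq X k).subset fun _ hv => hv.1

/-- There are finitely many sections, so one `d` bounds the depth at which a nontrivial section
becomes active. A word counted on level `k` is then a prefix of an active word on one of the levels
`k, ..., k + d`, each holding at most `C` of them. Prefixing `u` transfers the bound from `g` to
`sec g u`. -/
theorem IsBounded.exists_ncard_le [Finite X] {g : TreeAut X} (hg : IsBounded g) :
    ∃ C, ∀ k u, (nontrivialWords k (sec g u)).ncard ≤ C := by
  obtain ⟨hfin, C, hC⟩ := hg
  have hd : ∃ d, ∀ h ∈ Set.range (sec g), h ≠ 1 → ∃ v x, v.length ≤ d ∧ (sec h v).1 [x] ≠ [x] := by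
    choose! V hV using fun (h : TreeAut X) (hh : h ≠ 1) => exists_active_of_ne_one hh
    obtain ⟨d, hd⟩ := (hfin.finite_range_sec.image fun h => (V h).length).bddAbove
    exact ⟨d, fun h hh h1 => 
      let ⟨x, hx⟩ := hV h h1
      ⟨V h, x, hd ⟨h, hh, rfl⟩, hx⟩⟩
  obtain ⟨d, hd⟩ := hd
  have h0 : ∀ k, (nontrivialWords k g).ncard ≤ (d + 1) * C := fun k => by
    have hsub : nontrivialWords k g ⊆
        ⋃ j ∈ Finset.range (d + 1), List.take k '' activeWords (k + j) g := by
      rintro v ⟨hv, h1⟩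
      obtain ⟨z, x, hz, hx⟩ := hd _ ⟨v, rfl⟩ h1
      simp only [Set.mem_iUnion]
      refine ⟨z.length, by simpa [Nat.lt_succ_iff] using hz, v ++ z, ⟨by simp [hv], x, ?_⟩, ?_⟩
      · rw [← sec_apply, sec_append]; exact hx
      · rw [← hv]; simp
    refine (Set.ncard_le_ncard hsub (Set.Finite.biUnion (Finset.finite_toSet _)
      fun j _ => (activeWords_finite _ g).image _)).trans ?_
    refine (Finset.set_ncard_biUnion_le _ _).trans ?_
    refine (Finset.sum_le_card_nsmul _ _ C fun j _ =>
      (Set.ncard_image_le (activeWords_finite _ g)).trans (hC _)).trans ?_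
    simp
  refine ⟨(d + 1) * C, fun k u => le_trans ?_ (h0 (u.length + k))⟩
  rw [← Set.ncard_image_of_injective _ (List.append_right_injective u)]
  refine Set.ncard_le_ncard ?_ (nontrivialWords_finite _ g)
  rintro _ ⟨v, ⟨hv, h1⟩, rfl⟩
  exact ⟨by simp [hv], by rwa [sec_append]⟩

end sections

/-! ### Nontrivial products are active at linear depth. -/

section depth

variable {X : Type u}

/-- `g` has nontrivial sections on every level. -/
def NonFinitary (g : TreeAut X) : Prop :=
  ∀ n, (nontrivialWords n g).Nonempty

theorem sec_eq_one_of_le {g : TreeAut X} {n : ℕ} (h : ∀ v : List X, v.length = n → sec g v = 1)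
    {v : List X} (hv : n ≤ v.length) : sec g v = 1 := by
  rw [← List.take_append_drop n v, sec_append, h _ (by simp [hv]), sec_one]

theorem NonFinitary.of_sec {g : TreeAut X} {v : List X} (h : NonFinitary (sec g v)) :
    NonFinitary g := by
  intro n
  by_contra hc
  have h1 : ∀ z : List X, z.length = n → sec g z = 1 := fun z hz => by
    by_contra hne
    exact hc ⟨z, hz, hne⟩
  obtain ⟨z, hz, hne⟩ := h n
  exact hne (by rw [← sec_append]; exact sec_eq_one_of_le h1 (by simp [hz]))

theorem NonFinitary.sec_take {g : TreeAut X} {v : List X} {i j : ℕ} (hij : i ≤ j)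
    (h : NonFinitary (sec g (v.take j))) : NonFinitary (sec g (v.take i)) := by
  have h1 : v.take j = v.take i ++ (v.take j).drop i := by
    conv_lhs => rw [← List.take_append_drop i (v.take j), List.take_take, min_eq_left hij]
  rw [h1, sec_append] at h
  exact h.of_sec

/-- If the numbers of nontrivial sections of `g` on the levels are bounded and `g|_u = g`, then
no other word of the same length as `u` leads to a section which is not finitary. -/
theorem eq_of_nonFinitary_sec [Finite X] {g : TreeAut X} {C : ℕ}
    (hC : ∀ k, (nontrivialWords k g).ncard ≤ C) {u v : List X} (hlen : v.length = u.length)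
    (hu : sec g u = g) (hv : NonFinitary (sec g v)) : v = u := by
  by_contra hne
  -- Each turn around the cycle `u` adds a nontrivial word that branches off through `v`, disjoint
  -- from those continuing along `u`.
  have key : ∀ a, a ≤ (nontrivialWords (a * u.length) g).ncard := by
    intro a
    induction a with
    | zero => exact Nat.zero_le _
    | succ a ih =>
      have hsub : (u ++ ·) '' nontrivialWords (a * u.length) g ∪
          (v ++ ·) '' nontrivialWords (a * u.length) (sec g v) ⊆
          nontrivialWords ((a + 1) * u.length) g := by
        rintro _ (⟨z, ⟨hz, h1⟩, rfl⟩ | ⟨z, ⟨hz, h1⟩, rfl⟩)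
        · exact ⟨by simp [hz, add_mul, add_comm], by rwa [sec_append, hu]⟩
        · exact ⟨by simp [hz, add_mul, add_comm, hlen], by rwa [sec_append]⟩
      have hdisj : Disjoint ((u ++ ·) '' nontrivialWords (a * u.length) g)
          ((v ++ ·) '' nontrivialWords (a * u.length) (sec g v)) := by
        rw [Set.disjoint_left]
        rintro _ ⟨z, _, rfl⟩ ⟨z', _, h⟩
        exact hne (List.append_inj_left h hlen)
      have hfin := fun k (h : TreeAut X) => nontrivialWords_finite k h
      refine le_trans ?_ (Set.ncard_le_ncard hsub (hfin _ _))
      rw [Set.ncard_union_eq hdisj ((hfin _ _).image _) ((hfin _ _).image _),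
        Set.ncard_image_of_injective _ (List.append_right_injective u),
        Set.ncard_image_of_injective _ (List.append_right_injective v)]
      exact Nat.add_le_add ih ((Set.ncard_pos (hfin _ _)).2 (hv _))
  exact absurd ((key (C + 1)).trans (hC _)) (by omega)

theorem sec_flatten_replicate {g : TreeAut X} {u : List X} (hu : sec g u = g) (n : ℕ) :
    sec g (List.replicate n u).flatten = g := by
  induction n with
  | zero => simp
  | succ n ih => rw [List.replicate_succ, List.flatten_cons, sec_append, hu, ih]

/-- `g` is its own section at a word of length `p`. -/
def IsPeriodic (p : ℕ) (g : TreeAut X) : Prop :=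
  ∃ u : List X, u.length = p ∧ sec g u = g

/-- By `eq_of_nonFinitary_sec` the first `p` letters of `v` must spell the period `u`. Rotating `u`
by one letter gives a period of the next section along `v`. -/
theorem IsPeriodic.sec_take [Finite X] {g : TreeAut X} {C p : ℕ} (hp : 0 < p)
    (hC : ∀ k, (nontrivialWords k g).ncard ≤ C) (hg : IsPeriodic p g) {v : List X}
    (hlen : p ≤ v.length) (hv : NonFinitary (sec g (v.take p))) :
    sec g (v.take p) = g ∧ IsPeriodic p (sec g (v.take 1)) := by
  obtain ⟨u, rfl, hu⟩ := hg
  have h1 : v.take u.length = u := eq_of_nonFinitary_sec hC (by simp [hlen]) hu hv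
  refine ⟨by rw [h1, hu], u.drop 1 ++ u.take 1, by simp; omega, ?_⟩
  have h2 : v.take 1 = u.take 1 := by
    rw [← h1, List.take_take, min_eq_left (by omega)]
  rw [h2, ← sec_append, ← List.append_assoc, List.take_append_drop, sec_append, hu]

/-- The uniform time after which the behaviour of the sections along a word repeats. -/
theorem exists_window [Finite X] {S : Set (TreeAut X)} (hS : S.Finite)
    (hsec : ∀ g ∈ S, ∀ v, sec g v ∈ S) {C : ℕ}
    (hC : ∀ g ∈ S, ∀ k, (nontrivialWords k g).ncard ≤ C) :
    ∃ D p : ℕ, 0 < p ∧ ∀ g ∈ S, ∀ v : List X, D + p ≤ v.length →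
      (NonFinitary g → NonFinitary (sec g (v.take (D + p)))) →
      sec g (v.take D) = sec g (v.take (D + p)) := by
  have hd : ∃ d, ∀ g ∈ S, ¬ NonFinitary g → ∀ v : List X, d ≤ v.length → sec g v = 1 := by
    have h1 : ∀ g : TreeAut X, ¬ NonFinitary g →
        ∃ n, ∀ v : List X, n ≤ v.length → sec g v = 1 := fun g hg => by
      simp only [NonFinitary, not_forall, Set.not_nonempty_iff_eq_empty] at hg
      obtain ⟨n, hn⟩ := hg
      refine ⟨n, fun v hv => sec_eq_one_of_le (fun z hz => ?_) hv⟩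
      by_contra hne
      exact (Set.eq_empty_iff_forall_notMem.1 hn z) ⟨hz, hne⟩
    choose! N hN using h1
    obtain ⟨d, hd⟩ := (hS.image N).bddAbove
    exact ⟨d, fun g hg hnf v hv => hN g hnf v ((hd ⟨g, hg, rfl⟩).trans hv)⟩
  obtain ⟨d, hd⟩ := hd
  let s := S.ncard
  -- After `d` letters finitary elements are trivial; among `s + 1` successive sections two
  -- coincide; `s!` is a common multiple of all the resulting periods.
  refine ⟨max d s, s.factorial, s.factorial_pos, fun g hg v hv hnf => ?_⟩
  set D := max d s with hD
  set p := s.factorial with hp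
  have hp0 : 0 < p := s.factorial_pos
  by_cases hgn : NonFinitary g
  swap
  · rw [hd g hg hgn _ (by simp; omega), hd g hg hgn _ (by simp; omega)]
  have hnf' := hnf hgn
  -- some section on the first `s` levels is periodic
  have hper : ∃ i ≤ s, IsPeriodic p (sec g (v.take i)) := by
    obtain ⟨i, hi, j, hj, hij, he⟩ : ∃ i ∈ Finset.range (s + 1), ∃ j ∈ Finset.range (s + 1),
        i ≠ j ∧ sec g (v.take i) = sec g (v.take j) := by
      refine Finset.exists_ne_map_eq_of_card_lt_of_maps_to (t := hS.toFinset) ?_ ?_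
      · rw [← Set.ncard_eq_toFinset_card S hS]; simp [s]
      · intro i _; simpa using hsec g hg _
    wlog hlt : i < j generalizing i j
    · exact this j hj i hi hij.symm he.symm (by omega)
    rw [Finset.mem_range] at hi hj
    refine ⟨i, by omega, ?_⟩
    obtain ⟨n, hn⟩ : j - i ∣ p := Nat.dvd_factorial (by omega) (by omega)
    have hu : sec (sec g (v.take i)) ((v.take j).drop i) = sec g (v.take i) := by
      rw [← sec_append, he]
      congr 1
      conv_rhs => rw [← List.take_append_drop i (v.take j), List.take_take, min_eq_left hlt.le]
    refine ⟨_, ?_, sec_flatten_replicate hu n⟩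
    have : j ≤ v.length := by omega
    simp [hn, this, mul_comm]
  obtain ⟨i, his, hi⟩ := hper
  -- Periodicity first appears at some level `i ≤ s`, possibly different for each `g` and `v`; it is
  -- carried letter by letter to the uniform level `D`.
  have step : ∀ t, i ≤ t → t ≤ D → IsPeriodic p (sec g (v.take t)) →
      sec g (v.take (t + p)) = sec g (v.take t) ∧ IsPeriodic p (sec g (v.take (t + 1))) := by
    intro t _ htD ht
    have h1 := ht.sec_take (v := v.drop t) hp0 (hC _ (hsec g hg _)) (by simp; omega)
    rw [← sec_append, ← List.take_add, ← sec_append, ← List.take_add] at h1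
    exact h1 (NonFinitary.sec_take (by omega) hnf')
  have hall : ∀ t, i ≤ t → t ≤ D → IsPeriodic p (sec g (v.take t)) := by
    intro t hit
    induction t, hit using Nat.le_induction with
    | base => exact fun _ => hi
    | succ t hit ih => exact fun h => (step t hit (by omega) (ih (by omega))).2
  exact (step D (by omega) le_rfl (hall D (by omega) le_rfl)).1.symm

/-- The sections of the factors of a product at a word. -/
def secList : List (TreeAut X) → List X → List (TreeAut X)
  | [], _ => []
  | g :: l, v => sec g (l.prod.1 v) :: secList l v

theorem prod_secList (l : List (TreeAut X)) (v : List X) :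
    (secList l v).prod = sec l.prod v := by
  induction l with
  | nil => simp [secList]
  | cons g l ih => rw [secList, List.prod_cons, ih, List.prod_cons, sec_mul]

open Classical in
/-- The number of factors whose sections at a word are not finitary. -/
noncomputable def nonFinitaryCount (l : List (TreeAut X)) (v : List X) : ℕ :=
  (secList l v).countP fun g => decide (NonFinitary g)

open Classical in
theorem nonFinitaryCount_cons_of_pos {g : TreeAut X} {l : List (TreeAut X)} {v : List X}
    (h : NonFinitary (sec g (l.prod.1 v))) :
    nonFinitaryCount (g :: l) v = nonFinitaryCount l v + 1 :=
  List.countP_cons_of_pos (decide_eq_true h)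

open Classical in
theorem nonFinitaryCount_cons_of_neg {g : TreeAut X} {l : List (TreeAut X)} {v : List X}
    (h : ¬ NonFinitary (sec g (l.prod.1 v))) :
    nonFinitaryCount (g :: l) v = nonFinitaryCount l v :=
  List.countP_cons_of_neg (by rwa [decide_eq_true_eq])

theorem nonFinitaryCount_le_length (l : List (TreeAut X)) (v : List X) :
    nonFinitaryCount l v ≤ l.length := by
  induction l with
  | nil => simp [nonFinitaryCount, secList]
  | cons g l ih =>
    by_cases h : NonFinitary (sec g (l.prod.1 v))
    · rw [nonFinitaryCount_cons_of_pos h]; simpa using ih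
    · rw [nonFinitaryCount_cons_of_neg h]; simpa using ih.trans (Nat.le_succ _)

/-- Sections of finitary automorphisms are finitary, so factors can only leave the count. -/
theorem nonFinitaryCount_anti (l : List (TreeAut X)) (v : List X) {i j : ℕ} (hij : i ≤ j) :
    nonFinitaryCount l (v.take j) ≤ nonFinitaryCount l (v.take i) := by
  induction l with
  | nil => simp [nonFinitaryCount, secList]
  | cons g l ih =>
    by_cases h : NonFinitary (sec g (l.prod.1 (v.take j)))
    · have h' : NonFinitary (sec g (l.prod.1 (v.take i))) := by
        rw [apply_take] at h ⊢
        exact h.sec_take hij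
      rw [nonFinitaryCount_cons_of_pos h, nonFinitaryCount_cons_of_pos h']
      omega
    · rw [nonFinitaryCount_cons_of_neg h]
      by_cases h' : NonFinitary (sec g (l.prod.1 (v.take i)))
      · rw [nonFinitaryCount_cons_of_pos h']; omega
      · rwa [nonFinitaryCount_cons_of_neg h']

/-- No factor can re-enter the count, so equal totals force every factor to keep its status. Then
`hwin` applies to each factor separately, along the image of `v` under the factors to its right. -/
theorem secList_eq_of_count_eq [Finite X] {S : Set (TreeAut X)}
    (hsec : ∀ g ∈ S, ∀ v, sec g v ∈ S) {D p : ℕ}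
    (hwin : ∀ g ∈ S, ∀ v : List X, D + p ≤ v.length →
      (NonFinitary g → NonFinitary (sec g (v.take (D + p)))) →
      sec g (v.take D) = sec g (v.take (D + p)))
    (l : List (TreeAut X)) (hl : ∀ g ∈ l, g ∈ S) (v : List X) (i : ℕ)
    (hi : i + (D + p) ≤ v.length)
    (hcount : nonFinitaryCount l (v.take (i + (D + p))) = nonFinitaryCount l (v.take i)) :
    secList l (v.take (i + D)) = secList l (v.take (i + (D + p))) := by
  induction l with
  | nil => rfl
  | cons g l ih =>
    have hanti := nonFinitaryCount_anti l v (Nat.le_add_right i (D + p))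
    have himp : NonFinitary (sec g (l.prod.1 (v.take i))) →
        NonFinitary (sec g (l.prod.1 (v.take (i + (D + p))))) := fun h => by
      by_contra h'
      rw [nonFinitaryCount_cons_of_pos h, nonFinitaryCount_cons_of_neg h'] at hcount
      omega
    have hcount' : nonFinitaryCount l (v.take (i + (D + p))) = nonFinitaryCount l (v.take i) := by
      by_cases h : NonFinitary (sec g (l.prod.1 (v.take i)))
      · rw [nonFinitaryCount_cons_of_pos h, nonFinitaryCount_cons_of_pos (himp h)] at hcount
        omega
      · rw [nonFinitaryCount_cons_of_neg h] at hcount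
        by_cases h' : NonFinitary (sec g (l.prod.1 (v.take (i + (D + p)))))
        · rw [apply_take] at h h'
          exact absurd (h'.sec_take (Nat.le_add_right _ _)) h
        · rwa [nonFinitaryCount_cons_of_neg h'] at hcount
    rw [secList, secList, ih (fun g hg => hl g (List.mem_cons_of_mem _ hg)) hcount']
    congr 1
    rw [apply_take] at himp
    rw [apply_take, apply_take] at *
    set y := l.prod.1 v with hy
    have hylen : y.length = v.length := l.prod.2.1 v
    have h1 := hwin _ (hsec g (hl g List.mem_cons_self) (y.take i)) (y.drop i)
      (by rw [List.length_drop]; omega)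
    rw [← sec_append, ← sec_append, ← List.take_add, ← List.take_add] at h1
    exact h1 himp

/-- A nontrivial product of `m` elements of a finite section-closed set of bounded automorphisms
is active at some word of length at most `T * m`. -/
theorem exists_depth [Finite X] {S : Set (TreeAut X)} (hS : S.Finite)
    (hsec : ∀ g ∈ S, ∀ v, sec g v ∈ S) {C : ℕ}
    (hC : ∀ g ∈ S, ∀ k, (nontrivialWords k g).ncard ≤ C) :
    ∃ T : ℕ, ∀ l : List (TreeAut X), (∀ g ∈ l, g ∈ S) → l.prod ≠ 1 →
      ∃ v x, v.length ≤ T * l.length ∧ (sec l.prod v).1 [x] ≠ [x] := by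
  obtain ⟨D, p, hp, hwin⟩ := exists_window hS hsec hC
  refine ⟨2 * (D + p), fun l hl hne => ?_⟩
  set g := l.prod with hg
  classical
  have hex : ∃ n, ∃ v x, v.length = n ∧ (sec g v).1 [x] ≠ [x] :=
    let ⟨v, x, h⟩ := exists_active_of_ne_one hne
    ⟨_, v, x, rfl, h⟩
  obtain ⟨v, x, hvn, hx⟩ := Nat.find_spec hex
  refine ⟨v, x, ?_, hx⟩
  by_contra hlong
  have hm : 1 ≤ l.length := by
    rcases l with _ | _
    · simp [hg] at hne
    · simp
  -- sections at different prefixes of `v` are different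
  have hdist : ∀ i j, i < j → j ≤ v.length → sec g (v.take i) ≠ sec g (v.take j) := by
    intro i j hij hj he
    -- Deleting the letters between positions `i` and `j` would give a shorter active word.
    refine Nat.find_min hex (m := i + (v.length - j)) (by omega) ⟨v.take i ++ v.drop j, x, ?_, ?_⟩
    · simp; omega
    · rw [sec_append, he, ← sec_append, List.take_append_drop]; exact hx
  -- The count starts at most at `l.length` and drops in each of `l.length + 1` windows, which is
  -- absurd. These windows fit into `v` because `l.length + 1 ≤ 2 * l.length`, whence the factor 2
  -- in the bound.
  have hstrict : ∀ i, i ≤ l.length →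
      nonFinitaryCount l (v.take ((i + 1) * (D + p))) + (i + 1) ≤ l.length := by
    have hlt : ∀ i, i ≤ l.length → nonFinitaryCount l (v.take ((i + 1) * (D + p))) <
        nonFinitaryCount l (v.take (i * (D + p))) := by
      intro i hi
      have hlen : i * (D + p) + (D + p) ≤ v.length := by
        have : (i + 1) * (D + p) ≤ 2 * l.length * (D + p) := Nat.mul_le_mul_right _ (by omega)
        nlinarith
      rw [add_mul, one_mul]
      refine lt_of_le_of_ne (nonFinitaryCount_anti l v (Nat.le_add_right _ _)) fun he => ?_
      have h1 := secList_eq_of_count_eq hsec hwin l hl v _ hlen he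
      refine hdist (i * (D + p) + D) (i * (D + p) + (D + p)) (by omega) hlen ?_
      rw [hg, ← prod_secList, ← prod_secList, h1]
    intro i
    induction i with
    | zero =>
      intro h0
      have := hlt 0 h0
      have := nonFinitaryCount_le_length l (v.take (0 * (D + p)))
      omega
    | succ i ih =>
      intro hi
      have := hlt (i + 1) hi
      have := ih (by omega)
      omega
  have := hstrict l.length le_rfl
  omega

end depth

/-! ### Multi-stack machines given by a transition table -/

/-- A multi-stack machine: in a state `s`, reading the top symbols of all stacks, it pops them all,
pushes words on the stacks and goes to a new state or halts. -/
structure StackMachine (K : Type) (Γ : K → Type) (S : Type) where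
  next : S → (∀ k, Option (Γ k)) → Option S
  push : S → (∀ k, Option (Γ k)) → ∀ k, List (Γ k)

namespace StackMachine

variable {K : Type} {Γ : K → Type} {S : Type}

/-- A configuration: the state (`none` after halting) and the contents of the stacks. -/
abbrev Conf (Γ : K → Type) (S : Type) := Option S × (∀ k, List (Γ k))

/-- One step of the machine. -/
def step (M : StackMachine K Γ S) : Conf Γ S → Option (Conf Γ S)
  | (none, _) => none
  | (some s, stk) => some (M.next s fun k => (stk k).head?,
      fun k => M.push s (fun k => (stk k).head?) k ++ (stk k).tail)

/-- `M.Run n c c'`: the machine goes from `c` to `c'` in at most `n` steps. -/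
def Run (M : StackMachine K Γ S) (n : ℕ) (c c' : Conf Γ S) : Prop :=
  ∃ t ≤ n, (flip bind M.step)^[t] (some c) = some c'

variable {M : StackMachine K Γ S}

theorem Run.refl (n : ℕ) (c : Conf Γ S) : M.Run n c c := ⟨0, Nat.zero_le _, rfl⟩

theorem Run.trans {m n : ℕ} {a b c : Conf Γ S} (h1 : M.Run m a b) (h2 : M.Run n b c) :
    M.Run (m + n) a c := by
  obtain ⟨s, hs, hs'⟩ := h1
  obtain ⟨t, ht, ht'⟩ := h2
  exact ⟨t + s, by omega, by rw [Function.iterate_add_apply, hs', ht']⟩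

theorem Run.mono {m n : ℕ} {a b : Conf Γ S} (h : M.Run m a b) (hmn : m ≤ n) : M.Run n a b :=
  let ⟨t, ht, h'⟩ := h
  ⟨t, ht.trans hmn, h'⟩

theorem Run.single {s : S} {stk stk' : ∀ k, List (Γ k)} {o : Option S}
    (h1 : M.next s (fun k => (stk k).head?) = o)
    (h2 : ∀ k, M.push s (fun k => (stk k).head?) k ++ (stk k).tail = stk' k) :
    M.Run 1 (some s, stk) (o, stk') :=
  ⟨1, le_rfl, congrArg some (Prod.ext h1 (funext h2))⟩

/-- The total height of the stacks grows at most linearly in time. -/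
theorem exists_growth [Fintype K] [∀ k, Finite (Γ k)] [Finite S] (M : StackMachine K Γ S) :
    ∃ B, ∀ n c c', M.Run n c c' →
      ∑ k, (c'.2 k).length ≤ ∑ k, (c.2 k).length + B * n := by
  classical
  cases nonempty_fintype S
  obtain ⟨B, hB⟩ := (Set.finite_range fun p : S × (∀ k, Option (Γ k)) =>
    ∑ k, (M.push p.1 p.2 k).length).bddAbove
  have hstep : ∀ c c', M.step c = some c' →
      ∑ k, (c'.2 k).length ≤ ∑ k, (c.2 k).length + B := by
    rintro ⟨_ | s, stk⟩ c' h
    · simp [step] at h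
    · simp only [step, Option.some.injEq] at h
      subst h
      have h1 := hB ⟨(s, fun k => (stk k).head?), rfl⟩
      simp only [List.length_append, Finset.sum_add_distrib, List.length_tail] at h1 ⊢
      have h2 : ∑ k, ((stk k).length - 1) ≤ ∑ k, (stk k).length :=
        Finset.sum_le_sum fun k _ => Nat.sub_le _ _
      omega
  refine ⟨B, ?_⟩
  rintro n c c' ⟨t, ht, h⟩
  have key : ∀ t c', (flip bind M.step)^[t] (some c) = some c' →
      ∑ k, (c'.2 k).length ≤ ∑ k, (c.2 k).length + B * t := by
    intro t
    induction t with
    | zero => rintro c' h; obtain rfl : c = c' := by simpa using h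
              simp
    | succ t ih =>
      intro c' h
      rw [Function.iterate_succ_apply'] at h
      rcases ho : (flip bind M.step)^[t] (some c) with _ | d
      · rw [ho] at h; simp [flip] at h
      · rw [ho] at h
        have := hstep d c' h
        have := ih d ho
        rw [mul_add]
        omega
  exact (key t c' h).trans (Nat.add_le_add_left (Nat.mul_le_mul_left _ ht) _)

/-! ### Translation into Mathlib's multi-stack machines. -/

section compile

open Turing Turing.TM2 Turing.TM2.Stmt

variable [DecidableEq K]

/-- Pops the stacks in a list, storing the popped symbols. -/
def popAll : List K → Stmt Γ S (∀ k, Option (Γ k)) → Stmt Γ S (∀ k, Option (Γ k))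
  | [], q => q
  | k :: ks, q => pop k (fun v o => Function.update v k o) (popAll ks q)

theorem stepAux_popAll (ks : List K) (hks : ks.Nodup) (q : Stmt Γ S (∀ k, Option (Γ k)))
    (v : ∀ k, Option (Γ k)) (stk : ∀ k, List (Γ k)) :
    stepAux (popAll ks q) v stk =
      stepAux q (fun k => if k ∈ ks then (stk k).head? else v k)
        (fun k => if k ∈ ks then (stk k).tail else stk k) := by
  induction ks generalizing v stk with
  | nil => simp [popAll]
  | cons a ks ih =>
    rw [List.nodup_cons] at hks
    rw [popAll, stepAux, ih hks.2]
    congr 1 <;> funext k <;> by_cases hk : k = a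
    · subst hk; simp [hks.1]
    · simp [hk]
    · subst hk; simp [hks.1]
    · simp [hk]

/-- Pushes a word on a stack. -/
def pushWord {σ : Type} (k : K) : List (Γ k) → Stmt Γ S σ → Stmt Γ S σ
  | [], q => q
  -- The tail is pushed before `a`, so the word lies on the stack in reading order.
  | a :: l, q => pushWord k l (Stmt.push k (fun _ => a) q)

theorem stepAux_pushWord {σ : Type} (k : K) (l : List (Γ k)) (q : Stmt Γ S σ) (v : σ)
    (stk : ∀ k, List (Γ k)) :
    stepAux (pushWord k l q) v stk = stepAux q v (Function.update stk k (l ++ stk k)) := by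
  induction l generalizing q stk with
  | nil => simp [pushWord]
  | cons a l ih => rw [pushWord, ih, stepAux]; simp

/-- Pushes words on the stacks in a list. -/
def pushAll {σ : Type} (w : ∀ k, List (Γ k)) : List K → Stmt Γ S σ → Stmt Γ S σ
  | [], q => q
  | k :: ks, q => pushWord k (w k) (pushAll w ks q)

theorem stepAux_pushAll {σ : Type} (w : ∀ k, List (Γ k)) (ks : List K) (hks : ks.Nodup)
    (q : Stmt Γ S σ) (v : σ) (stk : ∀ k, List (Γ k)) :
    stepAux (pushAll w ks q) v stk =
      stepAux q v (fun k => if k ∈ ks then w k ++ stk k else stk k) := by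
  induction ks generalizing stk with
  | nil => simp [pushAll]
  | cons a ks ih =>
    rw [List.nodup_cons] at hks
    rw [pushAll, stepAux_pushWord, ih hks.2]
    congr 1
    funext k
    by_cases hk : k = a
    · subst hk; simp [hks.1]
    · simp [hk]

open Classical in
/-- Chooses a statement according to the internal state. -/
noncomputable def branchAll {σ : Type} (f : σ → Stmt Γ S σ) : List σ → Stmt Γ S σ
  | [] => halt
  | a :: l => branch (fun v => decide (v = a)) (f a) (branchAll f l)

theorem stepAux_branchAll {σ : Type} (f : σ → Stmt Γ S σ) (l : List σ) (v : σ) (hv : v ∈ l)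
    (stk : ∀ k, List (Γ k)) : stepAux (branchAll f l) v stk = stepAux (f v) v stk := by
  induction l with
  | nil => simp at hv
  | cons a l ih =>
    rw [branchAll, stepAux]
    by_cases h : v = a
    · simp [h]
    · simpa [h] using ih (by simpa [h] using hv)

/-- The statement which executes one step of a machine. -/
noncomputable def stmt [Fintype K] [Fintype (∀ k, Option (Γ k))] (M : StackMachine K Γ S) (s : S) :
    Stmt Γ S (∀ k, Option (Γ k)) :=
  popAll Finset.univ.toList <| branchAll (fun h => pushAll (M.push s h) Finset.univ.toList <|
    load (fun _ _ => none) <| (M.next s h).elim halt fun s' => goto fun _ => s')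
    Finset.univ.toList

/-- The configuration of the compiled machine. -/
def toCfg (c : Conf Γ S) : Cfg Γ S (∀ k, Option (Γ k)) := ⟨c.1, fun _ => none, c.2⟩

/-- Popping, branching and pushing form a single statement, which resets the internal register
before it ends; hence the translation preserves the number of steps exactly. -/
theorem step_stmt [Fintype K] [Fintype (∀ k, Option (Γ k))] (M : StackMachine K Γ S)
    (c : Conf Γ S) : TM2.step M.stmt (toCfg c) = (M.step c).map toCfg := by
  obtain ⟨_ | s, stk⟩ := c
  · rfl
  · simp only [toCfg, TM2.step, stmt, step, Option.map_some]
    rw [stepAux_popAll _ (Finset.nodup_toList _), stepAux_branchAll _ _ _ (by simp),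
      stepAux_pushAll _ _ (Finset.nodup_toList _), stepAux]
    simp only [Finset.mem_toList, Finset.mem_univ, if_true]
    rcases M.next s _ with _ | s' <;> rfl

theorem iterate_step_stmt [Fintype K] [Fintype (∀ k, Option (Γ k))] (M : StackMachine K Γ S)
    (t : ℕ) (o : Option (Conf Γ S)) :
    (flip bind (TM2.step M.stmt))^[t] (o.map toCfg) =
      ((flip bind M.step)^[t] o).map toCfg := by
  induction t generalizing o with
  | zero => rfl
  | succ t ih =>
    rw [Function.iterate_succ_apply, Function.iterate_succ_apply, ← ih]
    congr 1
    rcases o with _ | c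
    · rfl
    · exact step_stmt M c

/-- A multi-stack machine which decides a language in polynomial time yields a Turing machine in
Mathlib's sense. -/
theorem decidableInPolyTime [Fintype K] [∀ k, Fintype (Γ k)] [Fintype S]
    (M : StackMachine K Γ S) {A : Type} (inp out : K) (eA : Γ inp ≃ A) (eB : Γ out ≃ Bool)
    (s₀ : S) (L : Set (List A)) (p : Polynomial ℕ)
    (hM : ∀ w : List A, ∃ r : Bool, (r = true ↔ w ∈ L) ∧ M.Run (p.eval w.length)
      (some s₀, Function.update (fun _ => []) inp (w.map eA.symm))
      (none, Function.update (fun _ => []) out [eB.symm r])) :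
    DecidableInPolyTime L := by
  classical
  let tm : FinTM2 :=
    { K := K
      k₀ := inp
      k₁ := out
      Γ := Γ
      Λ := S
      main := s₀
      σ := ∀ k, Option (Γ k)
      initialState := fun _ => none
      m := M.stmt }
  refine ⟨{ tm := tm, inputAlphabet := eA, outputAlphabet := eB, time := p, outputsFun := ?_ }⟩
  intro w
  have hr := hM w
  let r := hr.choose
  obtain ⟨hrL, hrun⟩ : (r = true ↔ w ∈ L) ∧ M.Run (p.eval w.length) _ _ := hr.choose_spec
  let t := hrun.choose
  obtain ⟨ht, hrun⟩ : t ≤ _ ∧ (flip bind M.step)^[t] _ = _ := hrun.choose_spec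
  have hinit : initList tm ((id w).map eA.invFun) =
      toCfg (some s₀, Function.update (fun _ => []) inp (w.map eA.symm)) := by
    unfold initList toCfg
    congr 1
    funext k
    by_cases h : inp = k
    · subst h; simp [tm]
    · simp [tm, Ne.symm h]
  have hfin : haltList tm ((Computability.encodeBool (decide (w ∈ L))).map eB.invFun) =
      toCfg (none, Function.update (fun _ => []) out [eB.symm r]) := by
    have hdec : decide (w ∈ L) = r := by
      rw [Bool.eq_iff_iff, hrL, decide_eq_true_iff]
    unfold haltList toCfg
    rw [hdec]
    congr 1
    funext k
    by_cases h : out = k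
    · subst h; simp [tm, Computability.encodeBool]
    · simp [tm, Ne.symm h]
  refine { steps := t, evals_in_steps := ?_, steps_le_m := ht }
  rw [hinit]
  change (flip bind (TM2.step M.stmt))^[t] ((some _).map toCfg) = some (haltList tm _)
  rw [iterate_step_stmt, hrun, hfin]
  rfl

end compile

end StackMachine

/-! ### A machine which follows all sections of a word level by level -/

/-- An invertible automaton in which the transition to the trivial state is `none`. -/
structure Transducer (Q X : Type) where
  next : Q → X → Option Q
  out : Q → Equiv.Perm X

namespace Transducer

variable {Q X A : Type} (M : Transducer Q X)

/-- The action on letters of a word of states, the first of which acts first. -/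
def act : List Q → X → X
  | [], x => x
  | q :: l, x => act l (M.out q x)

/-- The section of a word of states at a letter, with the trivial states omitted. -/
def letterSection : List Q → X → List Q
  | [], _ => []
  | q :: l, x => (M.next q x).toList ++ letterSection l (M.out q x)

/-- The section of a word of states at a word. -/
def sections : List Q → List X → List Q
  | l, [] => l
  | l, x :: v => sections (M.letterSection l x) v

@[simp] theorem sections_nil_left (v : List X) : M.sections [] v = [] := by
  induction v with
  | nil => rfl
  | cons x v ih => exact ih

/-- All sections on the levels up to `n` of the words in `W` act trivially on letters. -/
def Inactive (n : ℕ) (W : List (List Q)) : Prop :=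
  ∀ l ∈ W, ∀ v, v.length ≤ n → ∀ x, M.act (M.sections l v) x = x

theorem inactive_zero {W : List (List Q)} :
    M.Inactive 0 W ↔ ∀ l ∈ W, ∀ x, M.act l x = x := by
  refine ⟨fun h l hl x => h l hl [] le_rfl x, fun h l hl v hv x => ?_⟩
  obtain rfl : v = [] := by simpa using hv
  exact h l hl x

/-- Empty sections can be dropped: everything below them is empty and acts trivially. This keeps the
number of words on a level below their total length. -/
theorem inactive_succ {n : ℕ} {W W' : List (List Q)}
    (hW' : ∀ l, l ∈ W' ↔ l ≠ [] ∧ ∃ l₀ ∈ W, ∃ x, l = M.letterSection l₀ x) :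
    M.Inactive (n + 1) W ↔ (∀ l ∈ W, ∀ x, M.act l x = x) ∧ M.Inactive n W' := by
  constructor
  · refine fun h => ⟨fun l hl x => h l hl [] (Nat.zero_le _) x, fun l hl v hv x => ?_⟩
    obtain ⟨_, l₀, hl₀, y, rfl⟩ := (hW' l).1 hl
    exact h l₀ hl₀ (y :: v) (by simpa using hv) x
  · rintro ⟨h0, h⟩ l hl (_ | ⟨y, v⟩) hv x
    · exact h0 l hl x
    · change M.act (M.sections (M.letterSection l y) v) x = x
      by_cases hne : M.letterSection l y = []
      · rw [hne, sections_nil_left]; rfl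
      · exact h _ ((hW' _).2 ⟨hne, l, hl, y, rfl⟩) v (by simpa using hv) x

/-! ### Total length of the sections on a level. -/

section weight

variable [Fintype X]

/-- The number of nontrivial sections of a state on the level `k`. -/
def weight : ℕ → Q → ℕ
  | 0, _ => 1
  | k + 1, q => ∑ x, (M.next q x).elim 0 (weight k)

/-- The total number of letters in the sections of a word of states on the level `k`. -/
def wordWeight (k : ℕ) (l : List Q) : ℕ := (l.map (M.weight k)).sum

/-- The total number of letters in the sections of words of states on the level `k`. -/
def levelWeight (k : ℕ) (W : List (List Q)) : ℕ := (W.map (M.wordWeight k)).sum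

@[simp] theorem wordWeight_nil (k : ℕ) : M.wordWeight k [] = 0 := rfl

@[simp] theorem wordWeight_append (k : ℕ) (l l' : List Q) :
    M.wordWeight k (l ++ l') = M.wordWeight k l + M.wordWeight k l' := by
  simp [wordWeight]

@[simp] theorem wordWeight_reverse (k : ℕ) (l : List Q) :
    M.wordWeight k l.reverse = M.wordWeight k l := by
  simp [wordWeight, List.map_reverse, List.sum_reverse]

theorem wordWeight_zero (l : List Q) : M.wordWeight 0 l = l.length := by
  induction l with
  | nil => rfl
  | cons q l ih => simp [wordWeight, weight, add_comm]

/-- Passing to the next level only shifts the index of the weight, so a bound for all indices is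
inherited. As `x` runs over `X`, so does the letter reaching each state, since states permute `X`;
the permutation `e` makes this usable in the induction. -/
theorem sum_wordWeight_letterSection (k : ℕ) (l : List Q) :
    ∑ x, M.wordWeight k (M.letterSection l x) = M.wordWeight (k + 1) l := by
  suffices h : ∀ e : Equiv.Perm X,
      ∑ x, M.wordWeight k (M.letterSection l (e x)) = M.wordWeight (k + 1) l from h 1
  induction l with
  | nil => simp [letterSection]
  | cons q l ih =>
    intro e
    simp only [letterSection, wordWeight_append, Finset.sum_add_distrib]
    have h1 := ih (M.out q * e)
    simp only [Equiv.Perm.mul_apply] at h1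
    rw [h1, Equiv.sum_comp e fun y => M.wordWeight k (M.next q y).toList]
    have h2 : M.wordWeight (k + 1) (q :: l) = M.weight (k + 1) q + M.wordWeight (k + 1) l := by
      simp [wordWeight]
    rw [h2, weight]
    congr 1
    refine Finset.sum_congr rfl fun y _ => ?_
    rcases M.next q y with _ | r <;> simp [wordWeight]

end weight

/-- The stacks of the machine. -/
inductive Stack (X : Type) : Type
  | inp | out | counter
  -- One working stack holds the current level and the other receives the next one; `buf x` collects
  -- the section at `x` of the word being read.
  | work (b : Bool)
  | buf (x : X)

/-- The symbols of the machine. -/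
abbrev Sym (A Q : Type) : Stack X → Type
  | .inp => A
  | .out => Bool
  | .counter => Unit
  | .work _ => Option Q
  | .buf _ => Q

/-- The states of the machine. -/
inductive State (X : Type) : Type
  | start | load
  | read (b : Bool) (f : X → X)
  | move (b : Bool) (o : Option X)
  | clean (r : Bool)

theorem finite_stack [Finite X] : Finite (Stack X) := by
  refine Finite.of_injective (β := Option (Option (Option (Bool ⊕ X)))) (fun
    | .inp => none
    | .out => some none
    | .counter => some (some none)
    | .work b => some (some (some (.inl b)))
    | .buf x => some (some (some (.inr x)))) ?_
  rintro (_ | _ | _ | _ | _) (_ | _ | _ | _ | _) h <;> simp_all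

theorem finite_state [Finite X] : Finite (State X) := by
  refine Finite.of_injective
    (β := Option (Option ((Bool × (X → X)) ⊕ ((Bool × Option X) ⊕ Bool)))) (fun
    | .start => none
    | .load => some none
    | .read b f => some (some (.inl (b, f)))
    | .move b o => some (some (.inr (.inl (b, o))))
    | .clean r => some (some (.inr (.inr r)))) ?_
  rintro (_ | _ | _ | _ | _) (_ | _ | _ | _ | _) h <;> simp_all

theorem finite_sym [Finite A] [Finite Q] (k : Stack X) : Finite (Sym A Q k) := by
  cases k <;> simp only [Sym] <;> infer_instance

open Classical in
/-- The transitions of the machine. -/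
noncomputable def machineNext (h : ∀ k : Stack X, Option (Sym A Q k)) :
    State X → Option (State X)
  | .start => some .load
  | .load => match h .inp with
    | none => some (.read false id)
    | some _ => some .load
  | .read b f => match (h (.work b) : Option (Option Q)) with
    | none => match h .counter with
      | none => some (.clean true)
      | some _ => some (.read (!b) id)
    | some none => if f = id then some (.move b none) else some (.clean false)
    | some (some q) => some (.read b (M.out q ∘ f))
  | .move b none =>
    if hx : ∃ x, (h (.buf x)).isSome then some (.move b (some hx.choose))
    else some (.read b id)
  | .move b (some x) => match h (.buf x) with
    | none => some (.move b none)
    | some _ => some (.move b (some x))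
  | .clean r => if ∀ k, h k = none then none else some (.clean r)

open Classical in
/-- The words pushed by the machine. -/
noncomputable def machinePush (ι : A → Option Q) (T : ℕ) (h : ∀ k : Stack X, Option (Sym A Q k)) :
    State X → ∀ k : Stack X, List (Sym A Q k)
  -- Each step pops every stack, so a stack left unchanged gets its top symbol back. The terminator
  -- is pushed now, to lie below the input word.
  | .start, .work false => [none]
  | .load, .inp => []
  | .load, .counter => match h .inp with
    | none => (h .counter).toList
    | some _ => List.replicate T () ++ (h .counter).toList
  | .load, .work false => match h .inp with
    | none => (h (.work false)).toList
    | some a => (ι a).toList.map some ++ (h (.work false)).toList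
  -- One unit is spent exactly when the current level is exhausted.
  | .read b _, .counter => match (h (.work b) : Option (Option Q)) with
    | none => []
    | some _ => (h .counter).toList
  | .read b _, .work c => if c = b then [] else (h (.work c)).toList
  | .read b f, .buf x => match (h (.work b) : Option (Option Q)) with
    | some (some q) => (M.next q (f x)).toList ++ (h (.buf x)).toList
    | _ => (h (.buf x)).toList
  -- A terminator is written only when some buffer is nonempty, so empty sections never reach the
  -- next level.
  | .move b none, .work c => if c = b then (h (.work c)).toList else
      if ∃ x, (h (.buf x)).isSome then none :: (h (.work c)).toList else (h (.work c)).toList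
  | .move b (some x), .work c => if c = b then (h (.work c)).toList else
      (h (.buf x)).toList.map some ++ (h (.work c)).toList
  | .move _ (some x), .buf y => if y = x then [] else (h (.buf y)).toList
  | .clean r, .out => if ∀ k, h k = none then [r] else []
  | .clean _, _ => []
  | _, k => (h k).toList

/-- The machine which follows the sections of a word level by level: the words on one level are on
one of the working stacks, terminated by `none`. -/
noncomputable def machine (ι : A → Option Q) (T : ℕ) :
    StackMachine (Stack X) (Sym A Q) (State X) where
  next s h := M.machineNext h s
  push s h := M.machinePush ι T h s

/-- The contents of the stacks during a computation. -/
def contents (i : List A) (n : ℕ) (b : Bool) (u v : List (Option Q)) (B : X → List Q) :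
    ∀ k : Stack X, List (Sym A Q k)
  | .inp => i
  | .out => []
  | .counter => List.replicate n ()
  | .work c => if c = b then u else v
  | .buf x => B x

/-- Encoding of a list of words. -/
def enc (W : List (List Q)) : List (Option Q) := W.flatMap fun l => l.map some ++ [none]

@[simp] theorem enc_nil : enc ([] : List (List Q)) = [] := rfl

@[simp] theorem enc_cons (l : List Q) (W : List (List Q)) :
    enc (l :: W) = l.map some ++ none :: enc W := by simp [enc]

theorem head?_toList_append_tail {α : Type} (l : List α) : l.head?.toList ++ l.tail = l := by
  cases l <;> rfl

theorem head?_replicate_append (n : ℕ) :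
    (List.replicate n ()).head?.toList ++ List.replicate (n - 1) () = List.replicate n () := by
  cases n <;> rfl

theorem contents_swap (i : List A) (n : ℕ) (b : Bool) (u v : List (Option Q)) (B : X → List Q) :
    contents i n b u v B = contents i n (!b) v u B := by
  funext k
  rcases k with _ | _ | _ | c | _ <;> try rfl
  cases b <;> cases c <;> rfl

variable (ι : A → Option Q) (T : ℕ)

theorem run_start (i : List A) :
    (M.machine ι T).Run 1 (some .start, contents i 0 false [] [] fun _ => [])
      (some .load, contents i 0 false [none] [] fun _ => []) := by
  refine StackMachine.Run.single rfl fun k => ?_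
  rcases k with _ | _ | _ | (_ | _) | _ <;>
    simp [machine, machinePush, contents, head?_toList_append_tail]

/-- Loading reverses the input, which puts the last factor, the one acting first, on top. -/
theorem run_load (i : List A) (n : ℕ) (u : List (Option Q)) :
    (M.machine ι T).Run (i.length + 1) (some .load, contents i n false u [] fun _ => [])
      (some (.read false id), contents [] (n + T * i.length) false
        ((i.filterMap ι).reverse.map some ++ u) [] fun _ => []) := by
  induction i generalizing n u with
  | nil =>
    refine StackMachine.Run.single rfl fun k => ?_
    rcases k with _ | _ | _ | (_ | _) | _ <;>
      simp [machine, machinePush, contents, head?_toList_append_tail, head?_replicate_append]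
  | cons a i ih =>
    have h1 : (M.machine ι T).Run 1 (some .load, contents (a :: i) n false u [] fun _ => [])
        (some .load, contents i (n + T) false ((ι a).toList.map some ++ u) [] fun _ => []) := by
      refine StackMachine.Run.single rfl fun k => ?_
      rcases k with _ | _ | _ | (_ | _) | _ <;>
        simp [machine, machinePush, contents, head?_toList_append_tail, head?_replicate_append]
      exact add_comm T n
    have h2 := (h1.trans (ih (n + T) ((ι a).toList.map some ++ u))).mono
      (n := (a :: i).length + 1) (by simp; omega)
    have h3 : n + T + T * i.length = n + T * (a :: i).length := by simp; ring
    have h4 : (i.filterMap ι).reverse.map some ++ ((ι a).toList.map some ++ u) =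
        ((a :: i).filterMap ι).reverse.map some ++ u := by
      rcases h : ι a with _ | q <;> simp [h]
    rwa [h3, h4] at h2

/-- The buffers receive the sections reversed; emptying them in `run_move_buf` restores the order.
-/
theorem run_read_word (b : Bool) (n : ℕ) (l : List Q) (f : X → X) (u v : List (Option Q))
    (B : X → List Q) :
    (M.machine ι T).Run l.length
      (some (.read b f), contents [] n b (l.map some ++ u) v B)
      (some (.read b (M.act l ∘ f)), contents [] n b u v
        fun x => (M.letterSection l (f x)).reverse ++ B x) := by
  induction l generalizing f B with
  | nil => exact StackMachine.Run.refl _ _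
  | cons q l ih =>
    have h1 : (M.machine ι T).Run 1
        (some (.read b f), contents [] n b ((q :: l).map some ++ u) v B)
        (some (.read b (M.out q ∘ f)), contents [] n b (l.map some ++ u) v
          fun x => (M.next q (f x)).toList ++ B x) := by
      refine StackMachine.Run.single ?_ fun k => ?_
      · simp [machine, machineNext, contents]
      · rcases k with _ | _ | _ | c | _ <;>
          simp [machine, machinePush, contents, head?_toList_append_tail, head?_replicate_append]
        by_cases hc : c = b <;> simp [hc, head?_toList_append_tail]
    have h2 := (h1.trans (ih (M.out q ∘ f) _)).mono (n := (q :: l).length) (by simp; omega)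
    have h3 : (fun x => (M.letterSection l ((M.out q ∘ f) x)).reverse ++
        ((M.next q (f x)).toList ++ B x)) =
        fun x => (M.letterSection (q :: l) (f x)).reverse ++ B x := by
      funext x
      rcases h : M.next q (f x) with _ | r <;> simp [letterSection, h]
    rw [h3] at h2
    exact h2

theorem run_read_end (b : Bool) (n : ℕ) (u v : List (Option Q)) (B : X → List Q) :
    (M.machine ι T).Run 1 (some (.read b id), contents [] n b (none :: u) v B)
      (some (.move b none), contents [] n b u v B) := by
  refine StackMachine.Run.single ?_ fun k => ?_
  · simp [machine, machineNext, contents]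
  · rcases k with _ | _ | _ | c | _ <;>
      simp [machine, machinePush, contents, head?_toList_append_tail, head?_replicate_append]
    by_cases hc : c = b <;> simp [hc, head?_toList_append_tail]

theorem run_read_reject (b : Bool) (n : ℕ) {f : X → X} (hf : f ≠ id) (u v : List (Option Q))
    (B : X → List Q) :
    (M.machine ι T).Run 1 (some (.read b f), contents [] n b (none :: u) v B)
      (some (.clean false), contents [] n b u v B) := by
  refine StackMachine.Run.single ?_ fun k => ?_
  · simp [machine, machineNext, contents, hf]
  · rcases k with _ | _ | _ | c | _ <;>
      simp [machine, machinePush, contents, head?_toList_append_tail, head?_replicate_append]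
    by_cases hc : c = b <;> simp [hc, head?_toList_append_tail]

theorem run_read_empty_succ (b : Bool) (n : ℕ) (f : X → X) (v : List (Option Q))
    (B : X → List Q) :
    (M.machine ι T).Run 1 (some (.read b f), contents [] (n + 1) b [] v B)
      (some (.read (!b) id), contents [] n (!b) v [] B) := by
  rw [← contents_swap]
  refine StackMachine.Run.single ?_ fun k => ?_
  · simp [machine, machineNext, contents, List.replicate_succ]
  · rcases k with _ | _ | _ | c | _ <;>
      simp [machine, machinePush, contents, head?_toList_append_tail]
    by_cases hc : c = b <;> simp [hc, head?_toList_append_tail]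

theorem run_read_empty_zero (b : Bool) (f : X → X) (v : List (Option Q))
    (B : X → List Q) :
    (M.machine ι T).Run 1 (some (.read b f), contents [] 0 b [] v B)
      (some (.clean true), contents [] 0 b [] v B) := by
  refine StackMachine.Run.single ?_ fun k => ?_
  · simp [machine, machineNext, contents]
  · rcases k with _ | _ | _ | c | _ <;>
      simp [machine, machinePush, contents, head?_toList_append_tail]
    by_cases hc : c = b <;> simp [hc, head?_toList_append_tail]

theorem run_move_buf [DecidableEq X] (b : Bool) (n : ℕ) (u v : List (Option Q)) (B : X → List Q)
    (x : X) :
    (M.machine ι T).Run ((B x).length + 1)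
      (some (.move b (some x)), contents [] n b u v B)
      (some (.move b none), contents [] n b u ((B x).reverse.map some ++ v)
        (Function.update B x [])) := by
  generalize hl : B x = l
  induction l generalizing B v with
  | nil =>
    refine StackMachine.Run.single ?_ fun k => ?_
    · simp [machine, machineNext, contents, hl]
    · rcases k with _ | _ | _ | c | y <;>
        simp [machine, machinePush, contents, head?_replicate_append]
      · by_cases hc : c = b <;> simp [hc, hl, head?_toList_append_tail]
      · by_cases hy : y = x
        · subst hy; simp [hl]
        · simp [hy, head?_toList_append_tail]
  | cons q l ih =>
    have h1 : (M.machine ι T).Run 1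
        (some (.move b (some x)), contents [] n b u v B)
        (some (.move b (some x)), contents [] n b u (some q :: v) (Function.update B x l)) := by
      refine StackMachine.Run.single ?_ fun k => ?_
      · simp [machine, machineNext, contents, hl]
      · rcases k with _ | _ | _ | c | y <;>
          simp [machine, machinePush, contents, head?_replicate_append]
        · by_cases hc : c = b <;> simp [hc, hl, head?_toList_append_tail]
        · by_cases hy : y = x
          · subst hy; simp [hl]
          · simp [hy, head?_toList_append_tail]
    have h2 := (h1.trans (ih (some q :: v) (Function.update B x l) (by simp))).mono
      (n := (q :: l).length + 1) (by simp; omega)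
    simpa using h2

/-! ### Time needed for a level and for all levels. -/

section time

variable [Fintype X]

/-- Moving a nonempty buffer of length `a` takes `a + 2 ≤ 3 * a` steps. The order in which buffers
are chosen is arbitrary, so `V'` is described only by its members and weights. -/
theorem run_move (b : Bool) (n : ℕ) (u : List (Option Q)) (V : List (List Q)) (B : X → List Q) :
    ∃ V', (M.machine ι T).Run (3 * ∑ x, (B x).length + 1)
        (some (.move b none), contents [] n b u (enc V) B)
        (some (.read b id), contents [] n b u (enc V') fun _ => []) ∧
      (∀ l, l ∈ V' ↔ l ∈ V ∨ l ≠ [] ∧ ∃ x, l = (B x).reverse) ∧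
      ∀ k, M.levelWeight k V' = M.levelWeight k V + ∑ x, M.wordWeight k (B x) := by
  classical
  induction hs : ∑ x, (B x).length using Nat.strong_induction_on generalizing B V with
  | _ s ih =>
  subst hs
  by_cases hx : ∃ x, B x ≠ []
  · have hx' : ∃ x, (B x).head?.isSome := by
      obtain ⟨x, hx⟩ := hx
      exact ⟨x, by rcases h : B x with _ | _ <;> simp_all⟩
    set x := hx'.choose with hxdef
    have hBx : B x ≠ [] := by
      have := hx'.choose_spec
      rw [← hxdef] at this
      rintro h
      simp [h] at this
    have hpos : 0 < (B x).length := List.length_pos_iff.2 hBx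
    have h1 : (M.machine ι T).Run 1
        (some (.move b none), contents [] n b u (enc V) B)
        (some (.move b (some x)), contents [] n b u (none :: enc V) B) := by
      refine StackMachine.Run.single ?_ fun k => ?_
      · simp only [machine, machineNext, contents]
        rw [dif_pos hx']
      · rcases k with _ | _ | _ | c | _ <;>
          simp [machine, machinePush, contents, head?_toList_append_tail, head?_replicate_append]
        have hx'' : ∃ x, (B x).head?.isSome = true := hx'
        have : ∃ x, ¬ B x = [] := hx
        by_cases hc : c = b <;> simp [hc, this, head?_toList_append_tail]
    have h2 := M.run_move_buf ι T b n u (none :: enc V) B x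
    have hsum : ∀ φ : List Q → ℕ, φ [] = 0 →
        ∑ y, φ (B y) = φ (B x) + ∑ y, φ (Function.update B x [] y) := by
      intro φ hφ
      rw [← Finset.add_sum_erase _ _ (Finset.mem_univ x),
        ← Finset.add_sum_erase _ (fun y => φ (Function.update B x [] y)) (Finset.mem_univ x)]
      simp only [Function.update_self, hφ, zero_add]
      congr 1
      refine Finset.sum_congr rfl fun y hy => ?_
      rw [Function.update_of_ne (Finset.ne_of_mem_erase hy)]
    have hlen := hsum List.length rfl
    obtain ⟨V', hrun, hmem, hw⟩ := ih _ (by omega) ((B x).reverse :: V) (Function.update B x []) rfl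
    rw [enc_cons] at hrun
    refine ⟨V', ((h1.trans h2).trans hrun).mono (by omega), fun l => ?_, fun k => ?_⟩
    · rw [hmem, List.mem_cons]
      constructor
      · rintro ((rfl | h) | ⟨hne, y, rfl⟩)
        · exact Or.inr ⟨by simpa using hBx, x, rfl⟩
        · exact Or.inl h
        · by_cases hy : y = x
          · subst hy; simp at hne
          · exact Or.inr ⟨hne, y, by rw [Function.update_of_ne hy]⟩
      · rintro (h | ⟨hne, y, rfl⟩)
        · exact Or.inl (Or.inr h)
        · by_cases hy : y = x
          · subst hy; exact Or.inl (Or.inl rfl)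
          · exact Or.inr ⟨hne, y, by rw [Function.update_of_ne hy]⟩
    · rw [hw, hsum (M.wordWeight k) rfl]
      simp [levelWeight]
      ring
  · push Not at hx
    obtain rfl : B = fun _ => [] := funext hx
    refine ⟨V, ?_, fun l => ?_, fun k => by simp⟩
    · refine (StackMachine.Run.single ?_ fun k => ?_).mono (Nat.le_add_left _ _)
      · simp [machine, machineNext, contents]
      · rcases k with _ | _ | _ | c | _ <;>
          simp [machine, machinePush, contents, head?_toList_append_tail, head?_replicate_append]
    · constructor
      · exact Or.inl
      · rintro (h | ⟨h1, _, rfl⟩)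
        · exact h
        · simp at h1

/-- The budget counts one step per letter read, two per word (its terminator and the return to
reading), and the moves from `run_move`. -/
theorem run_round (b : Bool) (n : ℕ) (W V : List (List Q)) :
    ((∃ l ∈ W, ∃ x, M.act l x ≠ x) ∧ ∃ stk, (M.machine ι T).Run
        (M.levelWeight 0 W + 2 * W.length + 3 * M.levelWeight 1 W)
        (some (.read b id), contents [] n b (enc W) (enc V) fun _ => []) (some (.clean false), stk)) ∨
    ((∀ l ∈ W, ∀ x, M.act l x = x) ∧ ∃ V', (M.machine ι T).Run
        (M.levelWeight 0 W + 2 * W.length + 3 * M.levelWeight 1 W)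
        (some (.read b id), contents [] n b (enc W) (enc V) fun _ => [])
        (some (.read b id), contents [] n b [] (enc V') fun _ => []) ∧
      (∀ l, l ∈ V' ↔ l ∈ V ∨ l ≠ [] ∧ ∃ l₀ ∈ W, ∃ x, l = M.letterSection l₀ x) ∧
      ∀ k, M.levelWeight k V' = M.levelWeight k V + M.levelWeight (k + 1) W) := by
  induction W generalizing V with
  | nil => exact Or.inr ⟨by simp, V, StackMachine.Run.refl _ _, by simp, by simp [levelWeight]⟩
  | cons l W ih =>
    have hw : ∀ k, M.levelWeight k (l :: W) = M.wordWeight k l + M.levelWeight k W := by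
      simp [levelWeight]
    have h1 := M.run_read_word ι T b n l id (none :: enc W) (enc V) fun _ => []
    simp only [id, List.append_nil, Function.comp_id] at h1
    rw [← M.wordWeight_zero] at h1
    have hcfg := enc_cons l W
    rw [hcfg, hw, hw, List.length_cons]
    by_cases hact : M.act l = id
    · rw [hact] at h1
      have h2 := M.run_read_end ι T b n (enc W) (enc V) fun x => (M.letterSection l x).reverse
      obtain ⟨V₁, h3, hmem₁, hw₁⟩ := M.run_move ι T b n (enc W) V
        fun x => (M.letterSection l x).reverse
      simp only [← M.wordWeight_zero, M.sum_wordWeight_letterSection, wordWeight_reverse, zero_add,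
        List.reverse_reverse] at h3 hmem₁ hw₁
      have h4 := (h1.trans h2).trans h3
      rcases ih V₁ with ⟨⟨l', hl', hx⟩, stk, h5⟩ | ⟨hall, V', h5, hmem, hw'⟩
      · exact Or.inl ⟨⟨l', List.mem_cons_of_mem _ hl', hx⟩, stk, (h4.trans h5).mono (by omega)⟩
      · refine Or.inr ⟨?_, V', (h4.trans h5).mono (by omega), fun l' => ?_, fun k => ?_⟩
        · rintro l' hl' x
          rcases List.mem_cons.1 hl' with rfl | hl'
          · rw [hact]; rfl
          · exact hall l' hl' x
        · rw [hmem, hmem₁]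
          simp only [List.exists_mem_cons_iff]
          tauto
        · rw [hw', hw₁, hw]; ring
    · obtain ⟨x, hx⟩ := Function.ne_iff.1 hact
      exact Or.inl ⟨⟨l, List.mem_cons_self, x, hx⟩, _, (h1.trans
        (M.run_read_reject ι T b n hact (enc W) (enc V) _)).mono (by omega)⟩

-- A round costs at most `N + 2 * (N + 1) + 3 * N` steps, plus one to swap stacks or accept. The
-- slack in `hlen` is for the initial list, whose only word may be empty; later words are nonempty.
open Classical in
theorem run_rounds (N n : ℕ) (b : Bool) (W : List (List Q)) (hN : ∀ k, M.levelWeight k W ≤ N)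
    (hlen : W.length ≤ N + 1) :
    ∃ stk, (M.machine ι T).Run ((n + 1) * (6 * N + 3))
      (some (.read b id), contents [] n b (enc W) [] fun _ => [])
      (some (.clean (decide (M.Inactive n W))), stk) := by
  induction n generalizing b W with
  | zero =>
    rcases M.run_round ι T b 0 W [] with ⟨hex, stk, h1⟩ | ⟨hall, V', h1, -, -⟩
    · have : ¬ M.Inactive 0 W := by rw [inactive_zero]; push Not; exact hex
      rw [decide_eq_false this]
      exact ⟨stk, h1.mono (by have := hN 0; have := hN 1; omega)⟩
    · rw [decide_eq_true (M.inactive_zero.2 hall)]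
      exact ⟨_, (h1.trans (M.run_read_empty_zero ι T b _ _ _)).mono
        (by have := hN 0; have := hN 1; omega)⟩
  | succ n ih =>
    rcases M.run_round ι T b (n + 1) W [] with ⟨⟨l, hl, x, hx⟩, stk, h1⟩ | ⟨hall, V', h1, hmem, hw⟩
    · have : ¬ M.Inactive (n + 1) W := fun h => hx (h l hl [] (Nat.zero_le _) x)
      rw [decide_eq_false this]
      exact ⟨stk, h1.mono (by have := hN 0; have := hN 1; rw [add_mul]; omega)⟩
    · simp only [List.not_mem_nil, false_or] at hmem
      have hw' : ∀ k, M.levelWeight k V' ≤ N := fun k => by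
        rw [hw]; simpa [levelWeight] using hN (k + 1)
      have hlen' : V'.length ≤ N + 1 := by
        refine le_trans ?_ ((hw' 0).trans (Nat.le_succ _))
        have hne : ∀ l ∈ V', 1 ≤ M.wordWeight 0 l := fun l hl => by
          rw [wordWeight_zero]; exact List.length_pos_iff.2 ((hmem l).1 hl).1
        simpa [levelWeight] using
          List.card_nsmul_le_sum (V'.map (M.wordWeight 0)) 1 (by simpa using hne)
      obtain ⟨stk, h2⟩ := ih (!b) V' hw' hlen'
      refine ⟨stk, ?_⟩
      have hiff := M.inactive_succ (n := n) hmem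
      have : decide (M.Inactive (n + 1) W) = decide (M.Inactive n V') := by
        rw [decide_eq_decide, hiff]
        exact and_iff_right hall
      rw [this]
      refine ((h1.trans (M.run_read_empty_succ ι T b n _ _ _)).trans h2).mono ?_
      have := hN 0
      have := hN 1
      rw [add_mul (n + 1)]
      omega

end time

-- The halting configuration may contain only the answer, so everything else is erased first.
open Classical in
theorem run_clean [Fintype (Stack X)] (r : Bool) (stk : ∀ k : Stack X, List (Sym A Q k)) :
    (M.machine ι T).Run (∑ k, (stk k).length + 1) (some (.clean r), stk)
      (none, Function.update (fun _ => []) .out [r]) := by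
  induction hs : ∑ k, (stk k).length using Nat.strong_induction_on generalizing stk with
  | _ s ih =>
  subst hs
  by_cases hall : ∀ k, stk k = []
  · obtain rfl : stk = fun _ => [] := funext hall
    refine (StackMachine.Run.single ?_ fun k => ?_).mono (Nat.le_add_left _ _)
    · simp [machine, machineNext]
    · rcases k with _ | _ | _ | c | _ <;> simp [machine, machinePush]
  · have hall' : ¬ ∀ k, (stk k).head? = none := by simpa using hall
    have h1 : (M.machine ι T).Run 1 (some (.clean r), stk)
        (some (.clean r), fun k => (stk k).tail) := by
      refine StackMachine.Run.single ?_ fun k => ?_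
      · simp only [machine, machineNext]
        rw [if_neg hall']
      · rcases k with _ | _ | _ | c | _ <;> simp [machine, machinePush]
        exact not_forall.1 hall
    have hlt : ∑ k, (stk k).tail.length < ∑ k, (stk k).length := by
      push Not at hall
      obtain ⟨k, hk⟩ := hall
      refine Finset.sum_lt_sum (fun k _ => by simp) ⟨k, Finset.mem_univ _, ?_⟩
      have := List.length_pos_iff.2 hk
      rw [List.length_tail]
      omega
    exact (h1.trans (ih _ hlt _ rfl)).mono (by omega)

/-- It is decidable in polynomial time whether the sections of a word on the first levels, up to
a linear bound, act trivially on letters. -/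
theorem decidableInPolyTime_inactive [Finite X] [Finite Q] [Finite A] (M : Transducer Q X)
    (C : ℕ) (hC : ∀ [Fintype X] (k : ℕ) (q : Q), M.weight k q ≤ C) (ι : A → Option Q) (T : ℕ) :
    DecidableInPolyTime {w : List A | M.Inactive (T * w.length) [(w.filterMap ι).reverse]} := by
  classical
  cases nonempty_fintype X
  have := finite_stack (X := X)
  have := finite_state (X := X)
  have := fun k => finite_sym (A := A) (Q := Q) (X := X) k
  cases nonempty_fintype (Stack X)
  cases nonempty_fintype (State X)
  have := fun k => Fintype.ofFinite (Sym A Q (X := X) k)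
  obtain ⟨B, hB⟩ := (M.machine ι T).exists_growth
  obtain ⟨p₀, heval⟩ : ∃ p₀ : Polynomial ℕ, ∀ m,
      p₀.eval m = 1 + (m + 1) + (T * m + 1) * (6 * (C * m) + 3) :=
    ⟨1 + (.X + 1) + (.C T * .X + 1) * (6 * (.C C * .X) + 3), fun m => by simp⟩
  -- Here `p₀` bounds the time to the verdict. By `exists_growth` the stacks then have total height
  -- at most `m + B * p₀`, which bounds the erasing up to one step.
  refine (M.machine ι T).decidableInPolyTime .inp .out (Equiv.refl _) (Equiv.refl _) .start _
    (p₀ + (.X + .C B * p₀ + 1)) fun w => ?_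
  set m := w.length with hm
  set l := (w.filterMap ι).reverse with hl
  refine ⟨decide (M.Inactive (T * m) [l]), by simp [hm, hl], ?_⟩
  have hinit : (Function.update (fun _ => []) .inp (w.map (Equiv.refl A).symm) :
      ∀ k : Stack X, List (Sym A Q k)) = contents w 0 false [] [] fun _ => [] := by
    funext k
    rcases k with _ | _ | _ | c | _ <;> simp [contents]
  rw [hinit]
  have h1 := M.run_start ι T w
  have h2 := M.run_load ι T w 0 [none]
  have hweight : ∀ k, M.levelWeight k [l] ≤ C * m := fun k => by
    have hlm : l.length ≤ m := by simpa [hl] using List.length_filterMap_le _ _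
    have := List.sum_le_card_nsmul (l.map (M.weight k)) C (by simpa using fun q _ => hC k q)
    simp only [List.length_map, smul_eq_mul] at this
    simp only [levelWeight, wordWeight, List.map_cons, List.map_nil, List.sum_cons, List.sum_nil,
      add_zero]
    exact this.trans (by rw [mul_comm]; exact Nat.mul_le_mul_left _ hlm)
  obtain ⟨stk, h3⟩ := M.run_rounds ι T (C * m) (T * m) false [l] hweight (by simp)
  have henc : enc [l] = l.map some ++ [none] := by simp
  rw [henc] at h3
  rw [zero_add, ← hm, ← hl] at h2
  have h4 := (h1.trans h2).trans h3
  have hgrow := hB _ _ _ h4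
  have hsum : ∑ k, (contents (X := X) (Q := Q) w 0 false [] [] (fun _ => []) k).length = m := by
    rw [Finset.sum_eq_single_of_mem Stack.inp (Finset.mem_univ _)]
    · rfl
    · intro k _ hk
      rcases k with _ | _ | _ | c | _ <;> simp_all [contents]
  have h5 := M.run_clean ι T (decide (M.Inactive (T * m) [l])) stk
  refine (h4.trans h5).mono ?_
  simp only [hsum] at hgrow
  simp only [Polynomial.eval_add, Polynomial.eval_mul, Polynomial.eval_C, Polynomial.eval_X,
    Polynomial.eval_one, heval]
  omega

end Transducer

/-! ### The word problem for groups of bounded automorphisms -/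

section wordProblem

variable {X : Type u}

theorem apply_singleton_eq_headD (g : TreeAut X) (x : X) : g.1 [x] = [(g.1 [x]).headD x] := by
  obtain ⟨y, hy⟩ := List.length_eq_one_iff.1 (g.2.1 [x])
  simp [hy]

/-- The action of a tree automorphism on the first level. -/
def firstLevel (g : TreeAut X) : Equiv.Perm X where
  toFun x := (g.1 [x]).headD x
  invFun x := ((g⁻¹).1 [x]).headD x
  left_inv x := by
    dsimp only
    rw [← apply_singleton_eq_headD, inv_apply_self]
    rfl
  right_inv x := by
    dsimp only
    rw [← apply_singleton_eq_headD, apply_inv_self]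
    rfl

theorem apply_singleton_eq_firstLevel (g : TreeAut X) (x : X) : g.1 [x] = [firstLevel g x] :=
  apply_singleton_eq_headD g x

theorem firstLevel_mul (g h : TreeAut X) (x : X) :
    firstLevel (g * h) x = firstLevel g (firstLevel h x) := by
  have h1 := coe_mul_apply g h [x]
  simp only [apply_singleton_eq_firstLevel] at h1
  exact List.singleton_injective h1

theorem sum_ncard_nontrivialWords_le [Fintype X] (k : ℕ) (g : TreeAut X) :
    ∑ x, (nontrivialWords k (sec g [x])).ncard ≤ (nontrivialWords (k + 1) g).ncard := by
  have := fun k (h : TreeAut X) => (nontrivialWords_finite k h).to_subtype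
  simp only [← Nat.card_coe_set_eq]
  rw [← Nat.card_sigma]
  refine Nat.card_le_card_of_injective
    (fun p : (x : X) × nontrivialWords k (sec g [x]) =>
      (⟨p.1 :: p.2.1, by simp [p.2.2.1], by
        rw [← List.singleton_append, sec_append]; exact p.2.2.2⟩ :
        nontrivialWords (k + 1) g)) ?_
  rintro ⟨x, v, hv⟩ ⟨y, v', hv'⟩ h
  obtain ⟨rfl, rfl⟩ := List.cons.inj (congrArg Subtype.val h)
  rfl

open Classical in
/-- The name of a nontrivial element under an enumeration. -/
noncomputable def code {Q : Type} (val : Q → TreeAut X) (g : TreeAut X) : Option Q :=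
  if h : g ≠ 1 ∧ ∃ q, val q = g then some h.2.choose else none

theorem elim_code {Q : Type} {val : Q → TreeAut X} {g : TreeAut X}
    (hg : g ≠ 1 → ∃ q, val q = g) : (code val g).elim 1 val = g := by
  by_cases h : g = 1
  · simp [code, h]
  · have h1 : g ≠ 1 ∧ ∃ q, val q = g := ⟨h, hg h⟩
    rw [code, dif_pos h1]
    exact h1.2.choose_spec

/-- The automaton whose states are the names of the nontrivial sections. -/
noncomputable def sectionTransducer {Q Y : Type} (val : Q → TreeAut X) (e : X ≃ Y) :
    Transducer Q Y where
  next q y := code val (sec (val q) [e.symm y])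
  out q := e.permCongr (firstLevel (val q))

/-- The automorphism defined by a word of states, the first of which acts first. -/
def wordAut {Q : Type} (val : Q → TreeAut X) (l : List Q) : TreeAut X :=
  (l.reverse.map val).prod

theorem wordAut_cons {Q : Type} (val : Q → TreeAut X) (q : Q) (l : List Q) :
    wordAut val (q :: l) = wordAut val l * val q := by
  unfold wordAut
  rw [List.reverse_cons, List.map_append, List.prod_append, List.map_singleton,
    List.prod_singleton]

/-! ### The transducer of nontrivial sections. -/

section transducer

variable {Q Y : Type} (val : Q → TreeAut X) (e : X ≃ Y)

theorem act_sectionTransducer (l : List Q) (x : X) :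
    (sectionTransducer val e).act l (e x) = e (firstLevel (wordAut val l) x) := by
  induction l generalizing x with
  | nil => exact congrArg e (List.singleton_injective (apply_singleton_eq_firstLevel 1 x))
  | cons q l ih =>
    rw [Transducer.act, wordAut_cons, firstLevel_mul, ← ih]
    simp [sectionTransducer]

variable (hval : ∀ q v, sec (val q) v ≠ 1 → ∃ r, val r = sec (val q) v)
include hval

theorem wordAut_letterSection (l : List Q) (x : X) :
    wordAut val ((sectionTransducer val e).letterSection l (e x)) = sec (wordAut val l) [x] := by
  induction l generalizing x with
  | nil => exact (sec_one _).symm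
  | cons q l ih =>
    have hcode := elim_code (hval q [x])
    have hout : (sectionTransducer val e).out q (e x) = e (firstLevel (val q) x) := by
      simp [sectionTransducer]
    have hnext : (sectionTransducer val e).next q (e x) = code val (sec (val q) [x]) := by
      simp [sectionTransducer]
    rw [Transducer.letterSection, wordAut_cons, sec_mul, apply_singleton_eq_firstLevel, ← ih, hout,
      hnext]
    rcases h : code val (sec (val q) [x]) with _ | r
    · rw [h, Option.elim_none] at hcode
      rw [← hcode, mul_one]
      rfl
    · rw [h, Option.elim_some] at hcode
      rw [← hcode, ← wordAut_cons]
      rfl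

theorem wordAut_sections (l : List Q) (v : List X) :
    wordAut val ((sectionTransducer val e).sections l (v.map e)) = sec (wordAut val l) v := by
  induction v generalizing l with
  | nil => exact (sec_nil _).symm
  | cons x v ih =>
    rw [List.map_cons, Transducer.sections, ih, wordAut_letterSection val e hval, ← sec_append,
      List.singleton_append]

theorem inactive_sectionTransducer (n : ℕ) (l : List Q) :
    (sectionTransducer val e).Inactive n [l] ↔
      ∀ v : List X, v.length ≤ n → ∀ x, (sec (wordAut val l) v).1 [x] = [x] := by
  have key : ∀ (v : List X) x, (sectionTransducer val e).act
      ((sectionTransducer val e).sections l (v.map e)) (e x) = e x ↔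
      (sec (wordAut val l) v).1 [x] = [x] := fun v x => by
    rw [act_sectionTransducer, wordAut_sections val e hval, apply_singleton_eq_firstLevel]
    simp
  simp only [Transducer.Inactive, List.mem_singleton, forall_eq]
  constructor
  · exact fun h v hv x => (key v x).1 (h _ (by simpa using hv) _)
  · intro h v hv y
    have h1 := (key (v.map e.symm) (e.symm y)).2 (h _ (by simpa using hv) _)
    simpa using h1

/-- Paths through named states spell words with nontrivial section, so boundedness of the
automorphisms bounds the weights. -/
theorem weight_sectionTransducer_le [Finite X] [Fintype Y] (k : ℕ) (q : Q) (hq : ∀ q, val q ≠ 1) :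
    (sectionTransducer val e).weight k q ≤ (nontrivialWords k (val q)).ncard := by
  cases nonempty_fintype X
  induction k generalizing q with
  | zero =>
    refine (Set.ncard_pos (nontrivialWords_finite _ _)).2 ⟨[], rfl, ?_⟩
    rw [sec_nil]
    exact hq q
  | succ k ih =>
    refine le_trans ?_ (sum_ncard_nontrivialWords_le k (val q))
    rw [Transducer.weight, ← Equiv.sum_comp e]
    refine Finset.sum_le_sum fun x _ => ?_
    have hnext : (sectionTransducer val e).next q (e x) = code val (sec (val q) [x]) := by
      simp [sectionTransducer]
    have hcode := elim_code (hval q [x])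
    rw [hnext]
    rcases h : code val (sec (val q) [x]) with _ | r
    · exact Nat.zero_le _
    · rw [h, Option.elim_some] at hcode
      rw [← hcode]
      exact ih r

end transducer

/-- The triviality of products of given bounded automorphisms is decidable in polynomial time. -/
theorem decidableInPolyTime_prod_eq_one [Finite X] {A : Type} [Finite A] (s : A → TreeAut X)
    (hs : ∀ a, IsBounded (s a)) : DecidableInPolyTime {w : List A | (w.map s).prod = 1} := by
  cases nonempty_fintype A
  set S : Set (TreeAut X) := ⋃ a, Set.range (sec (s a)) with hS
  have hSfin : S.Finite := Set.finite_iUnion fun a => (hs a).1.finite_range_sec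
  have hsec : ∀ g ∈ S, ∀ v, sec g v ∈ S := by
    intro g hg v
    obtain ⟨a, u, rfl⟩ := Set.mem_iUnion.1 hg
    exact Set.mem_iUnion.2 ⟨a, u ++ v, sec_append _ _ _⟩
  have hmem : ∀ a, s a ∈ S := fun a => Set.mem_iUnion.2 ⟨a, [], sec_nil _⟩
  obtain ⟨C, hC⟩ : ∃ C, ∀ g ∈ S, ∀ k, (nontrivialWords k g).ncard ≤ C := by
    choose C hC using fun a => (hs a).exists_ncard_le
    refine ⟨∑ a, C a, fun g hg k => ?_⟩
    obtain ⟨a, u, rfl⟩ := Set.mem_iUnion.1 hg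
    exact (hC a k u).trans (Finset.single_le_sum (fun _ _ => Nat.zero_le _) (Finset.mem_univ a))
  obtain ⟨T, hT⟩ := exists_depth hSfin hsec hC
  have : Finite {g : TreeAut X // g ∈ S ∧ g ≠ 1} :=
    (hSfin.subset fun g (hg : g ∈ S ∧ g ≠ 1) => hg.1).to_subtype
  -- The machine's data live in `Type`, so states and letters are renamed by `Fin c` and `Fin d`.
  obtain ⟨c, ⟨eQ⟩⟩ := Finite.exists_equiv_fin {g : TreeAut X // g ∈ S ∧ g ≠ 1}
  obtain ⟨d, ⟨e⟩⟩ := Finite.exists_equiv_fin X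
  let val : Fin c → TreeAut X := fun q => (eQ.symm q).1
  have hval : ∀ g ∈ S, g ≠ 1 → ∃ q, val q = g := fun g hg h1 => ⟨eQ ⟨g, hg, h1⟩, by simp [val]⟩
  have hval' : ∀ q v, sec (val q) v ≠ 1 → ∃ r, val r = sec (val q) v := fun q v =>
    hval _ (hsec _ (eQ.symm q).2.1 v)
  have hdec := (sectionTransducer val e).decidableInPolyTime_inactive C
    (fun k q => (weight_sectionTransducer_le val e hval' k q fun q => (eQ.symm q).2.2).trans
      (hC _ (eQ.symm q).2.1 k)) (fun a => code val (s a)) T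
  have hset : {w : List A | (w.map s).prod = 1} = {w : List A | (sectionTransducer val e).Inactive
      (T * w.length) [(w.filterMap fun a => code val (s a)).reverse]} := by
    ext w
    have hprod : wordAut val (w.filterMap fun a => code val (s a)).reverse = (w.map s).prod := by
      unfold wordAut
      rw [List.reverse_reverse]
      induction w with
      | nil => rfl
      | cons a w ih =>
        have hcode := elim_code (hval _ (hmem a))
        rw [List.map_cons, List.prod_cons, ← ih]
        rcases h : code val (s a) with _ | q
        · rw [h, Option.elim_none] at hcode
          rw [List.filterMap_cons_none (f := fun a => code val (s a)) h, ← hcode, one_mul]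
        · rw [h, Option.elim_some] at hcode
          rw [List.filterMap_cons_some (f := fun a => code val (s a)) h, List.map_cons,
            List.prod_cons, hcode]
    rw [Set.mem_ofPred_eq, Set.mem_ofPred_eq, inactive_sectionTransducer val e hval', hprod]
    constructor
    · intro h v _ x
      rw [h, sec_one]
      rfl
    · intro h
      by_contra hne
      obtain ⟨v, x, hv, hx⟩ := hT (w.map s) (by simpa using fun a _ => hmem a) hne
      exact hx (h v (by simpa using hv) x)
  rw [hset]
  exact hdec

end wordProblem

end BoundedAutomata

theorem mainTheorem5 {X : Type*} [Finite X] (G : Subgroup (BoundedAutomata.TreeAut X))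
    (hG : G ≤ BoundedAutomata.boundedGroup X) (hfg : G.FG) :
    BoundedAutomata.WordProblemInPolyTime G := by
  intro n s _
  -- Inverses are letters in their own right, bounded because they lie in `G`.
  have h := BoundedAutomata.decidableInPolyTime_prod_eq_one
    (fun p : Fin n × Bool => ((if p.2 then s p.1 else (s p.1)⁻¹ : G) : BoundedAutomata.TreeAut X))
    fun p => hG (SetLike.coe_mem _)
  convert h using 2
  ext w
  rw [BoundedAutomata.wordValue, ← OneMemClass.coe_eq_one,
    SubmonoidClass.coe_list_prod, List.map_map]
  rfl
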